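/- Let $\mathfrak g$ be a finite-dimensional real Lie algebra. Regard $\Lambda^2\mathfrak g$ as the skew-symmetric tensors in $\mathfrak g\otimes\mathfrak g$, with $a\wedge b=a\otimes b-b\otimes a$. For $r=\sum_i a_i\otimes b_i$ put $$[[r,r]]=\sum_{i,j}\big([a_i,a_j]\otimes b_i\otimes b_j+a_i\otimes[b_i,a_j]\otimes b_j+a_i\otimes a_j\otimes[b_i,b_j]\big).$$ An element $r\in\Lambda^2\mathfrak g$ is an *$r$-matrix* if it solves the modified classical Yang–Baxter equation, i.e. $[[r,r]]\in\mathfrak g^{\otimes3}$ is $\mathfrak g$-invariant. A *Lie bialgebra* structure on $\mathfrak g$ is a linear map $\delta:\mathfrak g\to\mathfrak g\otimes\mathfrak g$ whose dual is a Lie bracket on $\mathfrak g^*$ and which satisfies $\delta([x,y])=x\cdot\delta(y)-y\cdot\delta(x)$; it is *coboundary* if $\delta=\delta_r$, $\delta_r(x)=x\cdot r$, for some $r\in\mathfrak g\otimes\mathfrak g$. Two structures $\delta,\delta'$ are equivalent if $(T\otimes T)\circ\delta=\delta'\circ T$ for some $T\in\mathrm{Aut}(\mathfrak g)$. Two $r$-matrices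 $r,s$ are equivalent if their reduced classes in $\Lambda^2\mathfrak g/(\Lambda^2\mathfrak g)^{\mathfrak g}$ lie in one orbit of $\mathrm{Aut}(\mathfrak g)$, i.e. $\Lambda^2T(r)-s\in(\Lambda^2\mathfrak g)^{\mathfrak g}$ for some $T\in\mathrm{Aut}(\mathfrak g)$; when $(\Lambda^2\mathfrak g)^{\mathfrak g}=0$ this is equivalence of $r$-matrices under $\mathrm{Aut}(\mathfrak g)$. Every real three-dimensional Lie algebra is abelian or isomorphic to one of the following, given by $([e_1,e_2],[e_1,e_3],[e_3,e_2])$ in a basis $e_1,e_2,e_3$: - $\mathfrak{sl}_2$: $(e_2,-e_3,-e_1)$; - $\mathfrak{su}_2$: $(e_3,-e_2,-e_1)$; - $\mathfrak h$: $(e_3,0,0)$; - $\mathfrak r'_{3,0}$: $(-e_3,e_2,0)$; - $\mathfrak r_{3,-1}$: $(e_2,-e_3,0)$; - $\mathfrak r_{3,1}$: $(e_2,e_3,0)$; - $\mathfrak r_3$: $(0,-e_1,e_1+e_2)$; - $\mathfrak r_{3,\lambda}$, $\lambda\in(-1,1)$: $(0,-e_1,\lambda e_2)$; - $\mathfrak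 r'_{3,\lambda}$, $\lambda>0$: $(0,e_2-\lambda e_1,\lambda e_2+e_1)$. Write $e_{ij}=e_i\wedge e_j$ and $r=xe_{12}+ye_{13}+ze_{23}$. Then the $r$-matrices, the invariants $(\Lambda^2\mathfrak g)^{\mathfrak g}$, and a complete list of pairwise inequivalent representatives, each followed by the set of all $r$-matrices equivalent to it, are as follows. - $\mathfrak{sl}_2$: every $r$ is an $r$-matrix; invariants $0$; $0$: $\{0\}$; $e_{12}$: $\{2xy-z^2=0\}\setminus\{0\}$; $k\,e_{23}$ $(k>0)$: $\{2xy-z^2=-k^2\}$; $k(e_{12}+e_{13})$ $(k>0)$: $\{2xy-z^2=2k^2\}$. - $\mathfrak{su}_2$: every $r$; invariants $0$; $0$: $\{0\}$; $a\,e_{12}$ $(a>0)$: $\{x^2+y^2+z^2=a^2\}$. - $\mathfrak h$: every $r$; invariants $\langle e_{13},e_{23}\rangle$; $0$: $\{x=0\}$; $e_{12}$: $\{x\ne0\}$. - $\mathfrak r'_{3,0}$: every $r$; invariants $\langle e_{23}\rangle$; $0$: $\{x=y=0\}$; $e_{12}$: $\{x^2+y^2>0\}$. - $\mathfrak r_{3,-1}$: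 every $r$; invariants $\langle e_{23}\rangle$; $0$: $\{x=y=0\}$; $e_{12}$: $\{xy=0,\ x^2+y^2\neq0\}$; $e_{12}+e_{13}$: $\{xy\ne0\}$. - $\mathfrak r_{3,1}$: every $r$; invariants $0$; $0$: $\{0\}$; $e_{13}$: $\{x^2+y^2\ne0\}$; $e_{23}$: $\{x=y=0,\ z\neq0\}$. - $\mathfrak r_3$: $r$-matrices $\{z=0\}$; invariants $0$; $0$: $\{0\}$; $e_{12}$: $\{x>0,\ y=z=0\}$; $-e_{12}$: $\{x<0,\ y=z=0\}$; $e_{13}$: $\{y\neq0,\ z=0\}$. - $\mathfrak r_{3,\lambda}$, $\lambda\in(-1,1)$: $r$-matrices $\{yz=0\}$; invariants $0$; $0$: $\{0\}$; $e_{23}$: $\{y=0,\ z\ne0\}$; $e_{13}$: $\{z=0,\ y\neq0\}$; $e_{12}$: $\{x\ne0,\ y=z=0\}$. - $\mathfrak r'_{3,\lambda}$, $\lambda>0$: $r$-matrices $\{y=z=0\}$; invariants $0$; $0$: $\{0\}$; $e_{12}$: $\{x>0,\ y=z=0\}$; $-e_{12}$: $\{x<0,\ y=z=0\}$. Moreover,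 for each representative $r$ the map $\delta_r$ is a coboundary Lie bialgebra structure, and every coboundary Lie bialgebra structure on $\mathfrak g$ is equivalent to $\delta_r$ for exactly one representative $r$ in the list. -/

import Mathlib

open scoped TensorProduct

noncomputable section

namespace CoboundaryBialgebra

/-! ### Lie bialgebras and `r`-matrices -/

section General

variable {g : Type*} [LieRing g] [LieAlgebra ℝ g]

/-- `a ∧ b = a ⊗ b - b ⊗ a`, as an element of `Λ²g ⊆ g ⊗ g`. -/
def wedge (a b : g) : g ⊗[ℝ] g := a ⊗ₜ[ℝ] b - b ⊗ₜ[ℝ] a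

variable (g) in
/-- `Λ²g`, realised as the space of skew-symmetric tensors in `g ⊗ g`. -/
def bivectors : Submodule ℝ (g ⊗[ℝ] g) where
  carrier := {t | TensorProduct.comm ℝ g g t = -t}
  add_mem' := by
    intro a b ha hb
    simp only [Set.mem_ofPred_eq] at ha hb ⊢
    rw [map_add, ha, hb, neg_add]
  zero_mem' := by simp
  smul_mem' := by
    intro c a ha
    simp only [Set.mem_ofPred_eq] at ha ⊢
    rw [map_smul, ha, smul_neg]

variable (g) in
/-- `(Λ²g)^g`: the bivectors annihilated by the action of `g`. -/
def invariantBivectors : Submodule ℝ (g ⊗[ℝ] g) :=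
  bivectors g ⊓ (LieModule.maxTrivSubmodule ℝ g (g ⊗[ℝ] g)).toSubmodule

variable (g) in
/-- The Lie bracket of `g` as a linear map `g ⊗ g → g`. -/
def bracketMap : g ⊗[ℝ] g →ₗ[ℝ] g := (LieModule.toModuleHom ℝ g g : g ⊗[ℝ] g →ₗ[ℝ] g)

variable (g) in
/-- `[r₁₂, s₁₃] + [r₁₂, s₂₃] + [r₁₃, s₂₃]`, as a linear map in `r ⊗ s`; see `yangBaxter_tmul`. -/
def yangBaxterMap : (g ⊗[ℝ] g) ⊗[ℝ] (g ⊗[ℝ] g) →ₗ[ℝ] g ⊗[ℝ] (g ⊗[ℝ] g) :=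
  (TensorProduct.map (bracketMap g) LinearMap.id) ∘ₗ
      (TensorProduct.tensorTensorTensorComm ℝ g g g g).toLinearMap
    + (TensorProduct.map LinearMap.id
          ((TensorProduct.map (bracketMap g) LinearMap.id) ∘ₗ
            (TensorProduct.assoc ℝ g g g).symm.toLinearMap)) ∘ₗ
        (TensorProduct.assoc ℝ g g (g ⊗[ℝ] g)).toLinearMap
    + (TensorProduct.assoc ℝ g g g).toLinearMap ∘ₗ
        (TensorProduct.map LinearMap.id (bracketMap g)) ∘ₗ
          (TensorProduct.tensorTensorTensorComm ℝ g g g g).toLinearMap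

/-- `[[r, r]] = [r₁₂, r₁₃] + [r₁₂, r₂₃] + [r₁₃, r₂₃] ∈ g ⊗ g ⊗ g`. -/
def yangBaxter (r : g ⊗[ℝ] g) : g ⊗[ℝ] (g ⊗[ℝ] g) := yangBaxterMap g (r ⊗ₜ[ℝ] r)

theorem yangBaxter_tmul (a b c d : g) :
    yangBaxterMap g ((a ⊗ₜ[ℝ] b) ⊗ₜ[ℝ] (c ⊗ₜ[ℝ] d)) =
      ⁅a, c⁆ ⊗ₜ[ℝ] (b ⊗ₜ[ℝ] d) + a ⊗ₜ[ℝ] (⁅b, c⁆ ⊗ₜ[ℝ] d) + a ⊗ₜ[ℝ] (c ⊗ₜ[ℝ] ⁅b, d⁆) := by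
  simp [yangBaxterMap, bracketMap]

/-- `r ∈ Λ²g` is an `r`-matrix if it solves the modified classical Yang–Baxter equation:
`[[r, r]]` is a `g`-invariant element of `g ⊗ g ⊗ g`. -/
def IsRMatrix (r : g ⊗[ℝ] g) : Prop :=
  r ∈ bivectors g ∧ ∀ x : g, ⁅x, yangBaxter r⁆ = 0

/-- The dual map of `δ : g → g ⊗ g`, as a bilinear operation on `g*`:
`[ξ, η](x) = (ξ ⊗ η)(δ x)`. -/
def dualBracket (δ : g →ₗ[ℝ] g ⊗[ℝ] g) (ξ η : Module.Dual ℝ g) : Module.Dual ℝ g :=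
  (TensorProduct.dualDistrib ℝ g g (ξ ⊗ₜ[ℝ] η)) ∘ₗ δ

/-- `(g, δ)` is a Lie bialgebra: the dual of `δ` is a Lie bracket on `g*` (its bilinearity is
automatic) and `δ` is a `1`-cocycle. -/
structure IsCocommutator (δ : g →ₗ[ℝ] g ⊗[ℝ] g) : Prop where
  dual_self : ∀ ξ : Module.Dual ℝ g, dualBracket δ ξ ξ = 0
  dual_jacobi : ∀ ξ η ζ : Module.Dual ℝ g,
    dualBracket δ ξ (dualBracket δ η ζ) + dualBracket δ η (dualBracket δ ζ ξ)
      + dualBracket δ ζ (dualBracket δ ξ η) = 0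
  cocycle : ∀ x y : g, δ ⁅x, y⁆ = ⁅x, δ y⁆ - ⁅y, δ x⁆

/-- The coboundary `δ_r(x) = [x, r]` of `r ∈ g ⊗ g`. -/
def coboundary (r : g ⊗[ℝ] g) : g →ₗ[ℝ] g ⊗[ℝ] g :=
  (LieModule.toEnd ℝ g (g ⊗[ℝ] g) : g →ₗ[ℝ] Module.End ℝ (g ⊗[ℝ] g)).flip r

theorem coboundary_apply (r : g ⊗[ℝ] g) (x : g) : coboundary r x = ⁅x, r⁆ := rfl

/-- `(g, δ)` is a coboundary Lie bialgebra. -/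
def IsCoboundaryCocommutator (δ : g →ₗ[ℝ] g ⊗[ℝ] g) : Prop :=
  IsCocommutator δ ∧ ∃ r : g ⊗[ℝ] g, δ = coboundary r

/-- The map `T ⊗ T`; on bivectors it is `Λ²T`. -/
def tensorSq (T : g ≃ₗ⁅ℝ⁆ g) : g ⊗[ℝ] g →ₗ[ℝ] g ⊗[ℝ] g :=
  TensorProduct.map (T : g →ₗ[ℝ] g) (T : g →ₗ[ℝ] g)

/-- `(g, δ₁)` and `(g, δ₂)` are isomorphic through a Lie algebra automorphism of `g`. -/
def CocommutatorEquiv (δ₁ δ₂ : g →ₗ[ℝ] g ⊗[ℝ] g) : Prop :=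
  ∃ T : g ≃ₗ⁅ℝ⁆ g, ∀ x : g, tensorSq T (δ₁ x) = δ₂ (T x)

/-- The reduced classes of the bivectors `r` and `s` in `Λ²g / (Λ²g)^g` lie in the same orbit
of `Aut(g)`. -/
def ReducedEquiv (r s : g ⊗[ℝ] g) : Prop :=
  ∃ T : g ≃ₗ⁅ℝ⁆ g, tensorSq T r - s ∈ invariantBivectors g

end General

/-! ### The nonabelian three-dimensional real Lie algebras -/

inductive Row : Type
  | sl2
  | su2
  | h
  | r3'zero
  | r3negOne
  | r3one
  | r3
  | r3lam (lam : ℝ) (hlam : lam ∈ Set.Ioo (-1 : ℝ) 1)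
  | r3'lam (lam : ℝ) (hlam : 0 < lam)

namespace Row

/-- The coordinates of `[e₁, e₂]`. -/
def b12 : Row → Fin 3 → ℝ
  | sl2 => ![0, 1, 0]
  | su2 => ![0, 0, 1]
  | h => ![0, 0, 1]
  | r3'zero => ![0, 0, -1]
  | r3negOne => ![0, 1, 0]
  | r3one => ![0, 1, 0]
  | r3 => ![0, 0, 0]
  | r3lam _ _ => ![0, 0, 0]
  | r3'lam _ _ => ![0, 0, 0]

/-- The coordinates of `[e₁, e₃]`. -/
def b13 : Row → Fin 3 → ℝ
  | sl2 => ![0, 0, -1]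
  | su2 => ![0, -1, 0]
  | h => ![0, 0, 0]
  | r3'zero => ![0, 1, 0]
  | r3negOne => ![0, 0, -1]
  | r3one => ![0, 0, 1]
  | r3 => ![-1, 0, 0]
  | r3lam _ _ => ![-1, 0, 0]
  | r3'lam lam _ => ![-lam, 1, 0]

/-- The coordinates of `[e₃, e₂]`. -/
def b32 : Row → Fin 3 → ℝ
  | sl2 => ![-1, 0, 0]
  | su2 => ![-1, 0, 0]
  | h => ![0, 0, 0]
  | r3'zero => ![0, 0, 0]
  | r3negOne => ![0, 0, 0]
  | r3one => ![0, 0, 0]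
  | r3 => ![1, 1, 0]
  | r3lam lam _ => ![0, lam, 0]
  | r3'lam lam _ => ![1, lam, 0]

end Row

/-- The Lie algebra on `ℝ³` whose standard basis satisfies the commutation relations of `ρ`. -/
def Alg (_ : Row) : Type := Fin 3 → ℝ

namespace Alg

variable (ρ : Row)

instance : AddCommGroup (Alg ρ) := inferInstanceAs (AddCommGroup (Fin 3 → ℝ))

instance : Module ℝ (Alg ρ) := inferInstanceAs (Module ℝ (Fin 3 → ℝ))

/-- The skew-symmetric bilinear operation determined by `[e₁, e₂]`, `[e₁, e₃]`, `[e₃, e₂]`. -/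
def brk (u v : Fin 3 → ℝ) : Fin 3 → ℝ :=
  (u 0 * v 1 - u 1 * v 0) • ρ.b12 + (u 0 * v 2 - u 2 * v 0) • ρ.b13
    + (u 2 * v 1 - u 1 * v 2) • ρ.b32

theorem brk_jacobi (u v w : Fin 3 → ℝ) :
    brk ρ u (brk ρ v w) = brk ρ (brk ρ u v) w + brk ρ v (brk ρ u w) := by
  cases ρ <;> ext i <;> fin_cases i <;>
    simp [brk, Row.b12, Row.b13, Row.b32] <;> ring

instance : LieRing (Alg ρ) where
  bracket u v := brk ρ u v
  add_lie u v w := by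
    change brk ρ (fun i => u i + v i) w = fun i => brk ρ u w i + brk ρ v w i
    ext i; simp [brk]; ring
  lie_add u v w := by
    change brk ρ u (fun i => v i + w i) = fun i => brk ρ u v i + brk ρ u w i
    ext i; simp [brk]; ring
  lie_self u := by
    change brk ρ u u = fun _ => 0
    ext i; simp [brk]; ring
  leibniz_lie u v w := brk_jacobi ρ u v w

instance : LieAlgebra ℝ (Alg ρ) where
  lie_smul t u v := by
    change brk ρ u (fun i => t * v i) = fun i => t * brk ρ u v i
    ext i; simp [brk]; ring

/-- The standard basis vectors: `e ρ 0 = e₁`, `e ρ 1 = e₂`, `e ρ 2 = e₃`. -/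
def e (i : Fin 3) : Alg ρ := (Pi.single i (1 : ℝ) : Fin 3 → ℝ)

/-- The commutation relations, in coordinates. -/
theorem lie_e :
    ⁅e ρ 0, e ρ 1⁆ = (ρ.b12 : Fin 3 → ℝ) ∧ ⁅e ρ 0, e ρ 2⁆ = (ρ.b13 : Fin 3 → ℝ) ∧
      ⁅e ρ 2, e ρ 1⁆ = (ρ.b32 : Fin 3 → ℝ) := by
  refine ⟨?_, ?_, ?_⟩
  · change brk ρ (Pi.single 0 1) (Pi.single 1 1) = _
    simp [brk]
  · change brk ρ (Pi.single 0 1) (Pi.single 2 1) = _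
    simp [brk]
  · change brk ρ (Pi.single 2 1) (Pi.single 1 1) = _
    simp [brk]

/-- The bivector `x e₁₂ + y e₁₃ + z e₂₃` with coordinates `v = (x, y, z)`. -/
def biv (v : Fin 3 → ℝ) : Alg ρ ⊗[ℝ] Alg ρ :=
  v 0 • wedge (e ρ 0) (e ρ 1) + v 1 • wedge (e ρ 0) (e ρ 2) + v 2 • wedge (e ρ 1) (e ρ 2)

end Alg

/-! ### The classification data

Bivectors are given by their coordinates `v = (x, y, z) = (v 0, v 1, v 2)` with respect to
`e₁₂, e₁₃, e₂₃`. -/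

/-- A class in the classification: a representative and the set of all `r`-matrices whose reduced
class is equivalent to that of the representative. -/
structure OrbitClass : Type where
  rep : Fin 3 → ℝ
  orbit : Set (Fin 3 → ℝ)

namespace Row

/-- The coordinates of the `r`-matrices. -/
def rMatrices : Row → Set (Fin 3 → ℝ)
  | sl2 => Set.univ
  | su2 => Set.univ
  | h => Set.univ
  | r3'zero => Set.univ
  | r3negOne => Set.univ
  | r3one => Set.univ
  | r3 => {v | v 2 = 0}
  | r3lam _ _ => {v | v 1 * v 2 = 0}
  | r3'lam _ _ => {v | v 1 = 0 ∧ v 2 = 0}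

/-- The coordinates of the `g`-invariant bivectors. -/
def invariants : Row → Set (Fin 3 → ℝ)
  | sl2 => {0}
  | su2 => {0}
  | h => {v | v 0 = 0}
  | r3'zero => {v | v 0 = 0 ∧ v 1 = 0}
  | r3negOne => {v | v 0 = 0 ∧ v 1 = 0}
  | r3one => {0}
  | r3 => {0}
  | r3lam _ _ => {0}
  | r3'lam _ _ => {0}

/-- The list of classes. -/
def classes : Row → Set OrbitClass
  | sl2 =>
      {⟨0, {0}⟩, ⟨![1, 0, 0], {v | 2 * v 0 * v 1 - v 2 ^ 2 = 0 ∧ v ≠ 0}⟩}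
        ∪ {c | ∃ k : ℝ, 0 < k ∧ c = ⟨![0, 0, k], {v | 2 * v 0 * v 1 - v 2 ^ 2 = -k ^ 2}⟩}
        ∪ {c | ∃ k : ℝ, 0 < k ∧ c = ⟨![k, k, 0], {v | 2 * v 0 * v 1 - v 2 ^ 2 = 2 * k ^ 2}⟩}
  | su2 =>
      {⟨0, {0}⟩}
        ∪ {c | ∃ a : ℝ, 0 < a ∧ c = ⟨![a, 0, 0], {v | v 0 ^ 2 + v 1 ^ 2 + v 2 ^ 2 = a ^ 2}⟩}
  | h => {⟨0, {v | v 0 = 0}⟩, ⟨![1, 0, 0], {v | v 0 ≠ 0}⟩}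
  | r3'zero =>
      {⟨0, {v | v 0 = 0 ∧ v 1 = 0}⟩, ⟨![1, 0, 0], {v | 0 < v 0 ^ 2 + v 1 ^ 2}⟩}
  | r3negOne =>
      {⟨0, {v | v 0 = 0 ∧ v 1 = 0}⟩,
        ⟨![1, 0, 0], {v | v 0 * v 1 = 0 ∧ v 0 ^ 2 + v 1 ^ 2 ≠ 0}⟩,
        ⟨![1, 1, 0], {v | v 0 * v 1 ≠ 0}⟩}
  | r3one =>
      {⟨0, {0}⟩, ⟨![0, 1, 0], {v | v 0 ^ 2 + v 1 ^ 2 ≠ 0}⟩,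
        ⟨![0, 0, 1], {v | v 0 = 0 ∧ v 1 = 0 ∧ v 2 ≠ 0}⟩}
  | r3 =>
      {⟨0, {0}⟩, ⟨![1, 0, 0], {v | 0 < v 0 ∧ v 1 = 0 ∧ v 2 = 0}⟩,
        ⟨![-1, 0, 0], {v | v 0 < 0 ∧ v 1 = 0 ∧ v 2 = 0}⟩,
        ⟨![0, 1, 0], {v | v 1 ≠ 0 ∧ v 2 = 0}⟩}
  | r3lam _ _ =>
      {⟨0, {0}⟩, ⟨![0, 0, 1], {v | v 1 = 0 ∧ v 2 ≠ 0}⟩,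
        ⟨![0, 1, 0], {v | v 2 = 0 ∧ v 1 ≠ 0}⟩,
        ⟨![1, 0, 0], {v | v 0 ≠ 0 ∧ v 1 = 0 ∧ v 2 = 0}⟩}
  | r3'lam _ _ =>
      {⟨0, {0}⟩, ⟨![1, 0, 0], {v | 0 < v 0 ∧ v 1 = 0 ∧ v 2 = 0}⟩,
        ⟨![-1, 0, 0], {v | v 0 < 0 ∧ v 1 = 0 ∧ v 2 = 0}⟩}

end Row

end CoboundaryBialgebra

end

/-!
The nonabelian part of the list comes from the position of the functional `tr ∘ ad`. If it is
nonzero, its kernel is an abelian ideal of dimension two (`exists_basis_of_traceAd_ne_zero`) on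
which some element acts with trace `1`; that action is a multiple of the identity or a companion
matrix of trace `1`, whose discriminant distinguishes real, double and complex eigenvalues. If it
vanishes, the bracket is `[u, v] = N (u × v)` with `N` symmetric, and an orthonormal eigenbasis of
`N` diagonalises the bracket (`hasDiagonalBasis_of_traceAd_eq_zero`); the signs of the eigenvalues,
up to permutation and a common factor, then determine the algebra.

In dimension three `[[r, r]] = c(r) e₁ ∧ e₂ ∧ e₃` for a quadratic form `c` (`yangBaxter_biv`), and
`x` acts on `e₁ ∧ e₂ ∧ e₃` through `tr (ad x)` (`lie_vol`). So `r` is an `r`-matrix if and only if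
`c(r) = 0` or `g` is unimodular. The Jacobiator of the dual bracket of `δ_r` is the pairing with
`x · [[r, r]]` (`dual_jacobiator`), so the same condition says that `δ_r` is a Lie bialgebra
structure. If `δ_r` has skew-symmetric values, the symmetric part of `r` is invariant and can be
dropped; and `T ⊗ T` carries `δ_r` to `δ_s` exactly when `(T ⊗ T) r - s` is invariant
(`cocommutatorEquiv_coboundary_iff`). Thus the classification of the coboundary structures is that
of the reduced `r`-matrices.

It remains to find the orbits of `Aut(g)` on `Λ²g / (Λ²g)^g`. For the simple algebras, comparing
`A N = N cof A` with `cof A = det A · A⁻ᵀ` gives `det A = 1`, so `Λ²A` preserves the quadratic form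
`N` on `Λ²g` (`extSq_su2`, `extSq_sl2`); conversely two vectors of equal norm are exchanged by the
rotation by `π` about their sum, up to a separate treatment of isotropic sums. For the solvable
algebras an automorphism preserves an abelian ideal of dimension two or the centre, which makes it
block triangular, and the orbits are read off from the blocks (`mem_orbit_of_reducedEquiv`), while
explicit triangular automorphisms move every vector to its representative (`reducedEquiv_rep`).
-/

noncomputable section

namespace CoboundaryBialgebra

/-! ### Skew-symmetric tensors and coboundaries -/

section General

variable {g : Type*} [LieRing g] [LieAlgebra ℝ g]

/-- The flip of the two factors is `g`-equivariant. -/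
theorem lie_comm_tensor (x : g) (t : g ⊗[ℝ] g) :
    ⁅x, TensorProduct.comm ℝ g g t⁆ = TensorProduct.comm ℝ g g ⁅x, t⁆ := by
  induction t with
  | zero => simp
  | tmul a b => simp [TensorProduct.LieModule.lie_tmul_right, add_comm]
  | add a b ha hb => simp [lie_add, ha, hb]

theorem tensorSq_lie (T : g ≃ₗ⁅ℝ⁆ g) (x : g) (t : g ⊗[ℝ] g) :
    tensorSq T ⁅x, t⁆ = ⁅T x, tensorSq T t⁆ := by
  induction t with
  | zero => simp
  | tmul a b => simp [tensorSq, TensorProduct.LieModule.lie_tmul_right, LieEquiv.map_lie]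
  | add a b ha hb => simp only [lie_add, map_add, ha, hb]

theorem tensorSq_comm (T : g ≃ₗ⁅ℝ⁆ g) (t : g ⊗[ℝ] g) :
    TensorProduct.comm ℝ g g (tensorSq T t) = tensorSq T (TensorProduct.comm ℝ g g t) := by
  induction t with
  | zero => simp
  | tmul a b => simp [tensorSq]
  | add a b ha hb => simp only [map_add, ha, hb]

theorem mem_bivectors {t : g ⊗[ℝ] g} : t ∈ bivectors g ↔ TensorProduct.comm ℝ g g t = -t :=
  Iff.rfl

theorem mem_invariantBivectors {t : g ⊗[ℝ] g} :
    t ∈ invariantBivectors g ↔ t ∈ bivectors g ∧ ∀ x : g, ⁅x, t⁆ = 0 := by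
  simp [invariantBivectors, LieModule.mem_maxTrivSubmodule]

theorem tensorSq_mem_bivectors (T : g ≃ₗ⁅ℝ⁆ g) {t : g ⊗[ℝ] g} (ht : t ∈ bivectors g) :
    tensorSq T t ∈ bivectors g := by
  rw [mem_bivectors] at *
  rw [tensorSq_comm, ht, map_neg]

/-- Since `T ⊗ T` intertwines `δ_r` with `δ_{(T ⊗ T) r}`, two coboundaries of bivectors are
equivalent exactly when the bivectors are equivalent modulo the kernel `(Λ²g)^g` of `r ↦ δ_r`. -/
theorem cocommutatorEquiv_coboundary_iff {r s : g ⊗[ℝ] g} (hr : r ∈ bivectors g)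
    (hs : s ∈ bivectors g) :
    CocommutatorEquiv (coboundary r) (coboundary s) ↔ ReducedEquiv r s := by
  refine exists_congr fun T => ?_
  rw [mem_invariantBivectors]
  simp only [coboundary_apply, tensorSq_lie, lie_sub, sub_eq_zero]
  constructor
  · intro h
    refine ⟨sub_mem (tensorSq_mem_bivectors T hr) hs, fun x => ?_⟩
    simpa using h (T.symm x)
  · exact fun h x => h.2 (T x)

/-- If `δ_r` takes skew-symmetric values, then the symmetric part of `r` is invariant, so `r` may
be replaced by its skew-symmetric part. -/
theorem exists_bivector_coboundary_eq {r : g ⊗[ℝ] g} (h : ∀ x : g, ⁅x, r⁆ ∈ bivectors g) :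
    ∃ s ∈ bivectors g, coboundary r = coboundary s := by
  refine ⟨(1 / 2 : ℝ) • (r - TensorProduct.comm ℝ g g r), ?_, ?_⟩
  · rw [mem_bivectors, map_smul, map_sub, TensorProduct.comm_comm, ← smul_neg, neg_sub]
  · ext x
    rw [coboundary_apply, coboundary_apply, lie_smul, lie_sub, lie_comm_tensor,
      mem_bivectors.1 (h x)]
    module

theorem coboundary_cocycle (r : g ⊗[ℝ] g) (x y : g) :
    coboundary r ⁅x, y⁆ = ⁅x, coboundary r y⁆ - ⁅y, coboundary r x⁆ := by
  simp only [coboundary_apply, lie_lie]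

theorem reducedEquiv_trans {r s t : g ⊗[ℝ] g}
    (h₁ : ReducedEquiv r s) (h₂ : ReducedEquiv s t) : ReducedEquiv r t := by
  obtain ⟨T, hT⟩ := h₁
  obtain ⟨S, hS⟩ := h₂
  have hcomp : ∀ u : g ⊗[ℝ] g, tensorSq (T.trans S) u = tensorSq S (tensorSq T u) := fun u => by
    induction u with
    | zero => simp
    | tmul a b => simp [tensorSq]
    | add a b ha hb => simp only [map_add, ha, hb]
  refine ⟨T.trans S, ?_⟩
  have h : tensorSq S (tensorSq T r - s) ∈ invariantBivectors g := by
    rw [mem_invariantBivectors] at hT ⊢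
    refine ⟨tensorSq_mem_bivectors S hT.1, fun x => ?_⟩
    have := tensorSq_lie S (S.symm x) (tensorSq T r - s)
    rw [hT.2, map_zero, LieEquiv.apply_symm_apply] at this
    exact this.symm
  rw [hcomp]
  convert add_mem h hS using 1
  rw [map_sub]
  abel

theorem lie_wedge (x a b : g) :
    ⁅x, wedge a b⁆ = wedge ⁅x, a⁆ b + wedge a ⁅x, b⁆ := by
  simp only [wedge, lie_sub, TensorProduct.LieModule.lie_tmul_right]
  abel

theorem tensorSq_wedge (T : g ≃ₗ⁅ℝ⁆ g) (a b : g) :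
    tensorSq T (wedge a b) = wedge (T a) (T b) := by
  simp [wedge, tensorSq]

end General

namespace Alg

variable (ρ : Row)

/-! ### Coordinates on `Alg ρ` and its tensor powers -/

/-- The identification of `Alg ρ` with `ℝ³`. -/
def coords : Alg ρ ≃ₗ[ℝ] (Fin 3 → ℝ) := LinearEquiv.refl ℝ (Fin 3 → ℝ)

/-- The standard basis of `Alg ρ`. -/
def basis : Module.Basis (Fin 3) ℝ (Alg ρ) := Module.Basis.ofEquivFun (coords ρ)

theorem basis_apply (i : Fin 3) : basis ρ i = e ρ i := by
  simp only [basis, Module.Basis.coe_ofEquivFun]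
  rfl

@[simp]
theorem repr_basis (u : Alg ρ) (i : Fin 3) : (basis ρ).repr u i = coords ρ u i := rfl

@[simp]
theorem coords_e (i : Fin 3) : coords ρ (e ρ i) = Pi.single i 1 := rfl

theorem coords_lie (u v : Alg ρ) : coords ρ ⁅u, v⁆ = brk ρ (coords ρ u) (coords ρ v) := rfl

theorem eq_sum (u : Alg ρ) :
    u = coords ρ u 0 • e ρ 0 + coords ρ u 1 • e ρ 1 + coords ρ u 2 • e ρ 2 := by
  have h := (basis ρ).sum_repr u
  simp only [Fin.sum_univ_three, basis_apply, repr_basis] at h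
  exact h.symm

/-- The coordinates of `u ∧ v` with respect to `e₁₂, e₁₃, e₂₃`. -/
def wedgeCoords (u v : Fin 3 → ℝ) : Fin 3 → ℝ :=
  ![u 0 * v 1 - u 1 * v 0, u 0 * v 2 - u 2 * v 0, u 1 * v 2 - u 2 * v 1]

variable {ρ} in
theorem wedge_eq (u v : Alg ρ) : wedge u v = biv ρ (wedgeCoords (coords ρ u) (coords ρ v)) := by
  conv_lhs => rw [eq_sum ρ u, eq_sum ρ v]
  simp only [wedge, biv, wedgeCoords, TensorProduct.tmul_add, TensorProduct.add_tmul,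
    TensorProduct.tmul_smul, ← TensorProduct.smul_tmul', Matrix.cons_val]
  module

/-- `v ↦ x e₁₂ + y e₁₃ + z e₂₃` as a linear map. -/
def bivLin : (Fin 3 → ℝ) →ₗ[ℝ] Alg ρ ⊗[ℝ] Alg ρ where
  toFun := biv ρ
  map_add' u v := by simp only [biv, Pi.add_apply]; module
  map_smul' c v := by simp only [biv, Pi.smul_apply, smul_eq_mul, RingHom.id_apply]; module

theorem biv_add (u v : Fin 3 → ℝ) : biv ρ (u + v) = biv ρ u + biv ρ v := (bivLin ρ).map_add u v
theorem biv_sub (u v : Fin 3 → ℝ) : biv ρ (u - v) = biv ρ u - biv ρ v := (bivLin ρ).map_sub u v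
theorem biv_smul (c : ℝ) (u : Fin 3 → ℝ) : biv ρ (c • u) = c • biv ρ u := (bivLin ρ).map_smul c u
theorem biv_zero : biv ρ 0 = 0 := (bivLin ρ).map_zero

/-- The basis `e_i ⊗ e_j` of `Alg ρ ⊗ Alg ρ`. -/
def basis2 : Module.Basis (Fin 3 × Fin 3) ℝ (Alg ρ ⊗[ℝ] Alg ρ) :=
  (basis ρ).tensorProduct (basis ρ)

theorem basis2_repr_tmul (u v : Alg ρ) (i j : Fin 3) :
    (basis2 ρ).repr (u ⊗ₜ v) (i, j) = coords ρ u i * coords ρ v j := by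
  simp [basis2, mul_comm]

theorem basis2_repr_comm (t : Alg ρ ⊗[ℝ] Alg ρ) (i j : Fin 3) :
    (basis2 ρ).repr (TensorProduct.comm ℝ _ _ t) (i, j) = (basis2 ρ).repr t (j, i) := by
  induction t with
  | zero => simp
  | tmul a b => simp only [TensorProduct.comm_tmul, basis2_repr_tmul, mul_comm]
  | add a b ha hb => simp only [map_add, Finsupp.add_apply, ha, hb]

theorem basis2_repr_biv (v : Fin 3 → ℝ) (i j : Fin 3) :
    (basis2 ρ).repr (biv ρ v) (i, j) = !![0, v 0, v 1; -v 0, 0, v 2; -v 1, -v 2, 0] i j := by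
  simp only [biv, wedge, map_add, map_sub, map_smul, Finsupp.add_apply, Finsupp.sub_apply,
    Finsupp.smul_apply, basis2_repr_tmul, coords_e]
  fin_cases i <;> fin_cases j <;> simp

theorem biv_injective : Function.Injective (biv ρ) := by
  intro u v h
  have key := fun i j => congrArg (fun t => (basis2 ρ).repr t (i, j)) h
  simp only [basis2_repr_biv] at key
  ext i
  fin_cases i
  · simpa using key 0 1
  · simpa using key 0 2
  · simpa using key 1 2

theorem mem_bivectors_of_repr {t : Alg ρ ⊗[ℝ] Alg ρ}
    (h : ∀ i j, (basis2 ρ).repr t (j, i) = -(basis2 ρ).repr t (i, j)) : t ∈ bivectors (Alg ρ) := by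
  rw [mem_bivectors]
  refine (basis2 ρ).ext_elem fun ⟨i, j⟩ => ?_
  simp [basis2_repr_comm, h i j]

theorem biv_mem_bivectors (v : Fin 3 → ℝ) : biv ρ v ∈ bivectors (Alg ρ) := by
  refine mem_bivectors_of_repr ρ fun i j => ?_
  simp only [basis2_repr_biv]
  fin_cases i <;> fin_cases j <;> simp

theorem exists_eq_biv {t : Alg ρ ⊗[ℝ] Alg ρ} (ht : t ∈ bivectors (Alg ρ)) :
    ∃ v, t = biv ρ v := by
  have h : ∀ i j, (basis2 ρ).repr t (j, i) = -(basis2 ρ).repr t (i, j) := fun i j => by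
    rw [← basis2_repr_comm, mem_bivectors.1 ht]; simp
  refine ⟨![(basis2 ρ).repr t (0, 1), (basis2 ρ).repr t (0, 2), (basis2 ρ).repr t (1, 2)],
    (basis2 ρ).ext_elem fun ⟨i, j⟩ => ?_⟩
  rw [basis2_repr_biv]
  have h0 := h 0 0
  have h1 := h 1 1
  have h2 := h 2 2
  have h01 := h 0 1
  have h02 := h 0 2
  have h12 := h 1 2
  fin_cases i <;> fin_cases j <;> simp <;> linarith

/-- The coordinates of `x · (v 0 e₁₂ + v 1 e₁₃ + v 2 e₂₃)`. -/
def act (x v : Fin 3 → ℝ) : Fin 3 → ℝ :=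
  v 0 • (wedgeCoords (brk ρ x (Pi.single 0 1)) (Pi.single 1 1)
      + wedgeCoords (Pi.single 0 1) (brk ρ x (Pi.single 1 1)))
    + v 1 • (wedgeCoords (brk ρ x (Pi.single 0 1)) (Pi.single 2 1)
      + wedgeCoords (Pi.single 0 1) (brk ρ x (Pi.single 2 1)))
    + v 2 • (wedgeCoords (brk ρ x (Pi.single 1 1)) (Pi.single 2 1)
      + wedgeCoords (Pi.single 1 1) (brk ρ x (Pi.single 2 1)))

theorem lie_biv (x : Alg ρ) (v : Fin 3 → ℝ) : ⁅x, biv ρ v⁆ = biv ρ (act ρ (coords ρ x) v) := by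
  rw [act]
  simp only [biv_add, biv_smul]
  rw [biv]
  simp only [lie_add, lie_smul, lie_wedge]
  simp only [wedge_eq, coords_lie, coords_e, smul_add]

/-- The coordinates of the image of `v 0 e₁₂ + v 1 e₁₃ + v 2 e₂₃` under `Λ²A`, where `A` is the
linear map sending the standard basis to `f`. -/
def extSq (f : Fin 3 → Fin 3 → ℝ) (v : Fin 3 → ℝ) : Fin 3 → ℝ :=
  v 0 • wedgeCoords (f 0) (f 1) + v 1 • wedgeCoords (f 0) (f 2) + v 2 • wedgeCoords (f 1) (f 2)

theorem tensorSq_biv (T : Alg ρ ≃ₗ⁅ℝ⁆ Alg ρ) (v : Fin 3 → ℝ) :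
    tensorSq T (biv ρ v) = biv ρ (extSq (fun i => coords ρ (T (e ρ i))) v) := by
  rw [extSq]
  simp only [biv_add, biv_smul]
  rw [biv]
  simp only [map_add, map_smul, tensorSq_wedge]
  simp only [wedge_eq]

theorem biv_mem_invariantBivectors_iff (v : Fin 3 → ℝ) :
    biv ρ v ∈ invariantBivectors (Alg ρ) ↔ v ∈ ρ.invariants := by
  rw [mem_invariantBivectors, and_iff_right (biv_mem_bivectors ρ v)]
  have h1 : (∀ x : Alg ρ, ⁅x, biv ρ v⁆ = 0) ↔ ∀ x, act ρ x v = 0 := by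
    simp only [lie_biv, ← biv_zero ρ, (biv_injective ρ).eq_iff]
    exact Iff.rfl
  rw [h1]
  constructor
  · intro h
    have hh := fun i j => congrFun (h (Pi.single i 1)) j
    cases ρ <;>
    simp [Fin.forall_fin_succ, act, brk, wedgeCoords, Row.b12, Row.b13, Row.b32,
      Row.invariants, funext_iff] at hh ⊢ <;> grind
  · intro h x
    ext i
    cases ρ <;>
    simp [act, brk, wedgeCoords, Row.b12, Row.b13, Row.b32,
      Row.invariants] at h ⊢ <;> fin_cases i <;> simp [h]

theorem mem_invariants_iff (r : Alg ρ ⊗[ℝ] Alg ρ) :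
    r ∈ invariantBivectors (Alg ρ) ↔ ∃ v ∈ ρ.invariants, r = Alg.biv ρ v := by
  constructor
  · intro h
    obtain ⟨v, rfl⟩ := exists_eq_biv ρ (mem_invariantBivectors.1 h).1
    exact ⟨v, (biv_mem_invariantBivectors_iff ρ v).1 h, rfl⟩
  · rintro ⟨v, hv, rfl⟩
    exact (biv_mem_invariantBivectors_iff ρ v).2 hv

/-! ### The Yang–Baxter tensor -/

/-- `e₁ ∧ e₂ ∧ e₃`, as an antisymmetric tensor. -/
def vol : Alg ρ ⊗[ℝ] (Alg ρ ⊗[ℝ] Alg ρ) :=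
  e ρ 0 ⊗ₜ wedge (e ρ 1) (e ρ 2) - e ρ 1 ⊗ₜ wedge (e ρ 0) (e ρ 2) + e ρ 2 ⊗ₜ wedge (e ρ 0) (e ρ 1)

/-- The quadratic form `c` with `[[r, r]] = c(r) e₁ ∧ e₂ ∧ e₃`. -/
def ybCoeff (v : Fin 3 → ℝ) : ℝ :=
  v 0 * (v 0 * ρ.b12 2 + v 1 * ρ.b13 2 - v 2 * ρ.b32 2)
    - v 1 * (v 0 * ρ.b12 1 + v 1 * ρ.b13 1 - v 2 * ρ.b32 1)
    + v 2 * (v 0 * ρ.b12 0 + v 1 * ρ.b13 0 - v 2 * ρ.b32 0)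

/-- The trace of `ad u`. -/
def adTrace (u : Fin 3 → ℝ) : ℝ :=
  u 0 * (ρ.b12 1 + ρ.b13 2) + u 1 * (-ρ.b12 0 - ρ.b32 2) + u 2 * (-ρ.b13 0 + ρ.b32 1)

theorem lie_e_eq :
    ⁅e ρ 0, e ρ 1⁆ = ρ.b12 0 • e ρ 0 + ρ.b12 1 • e ρ 1 + ρ.b12 2 • e ρ 2 ∧
    ⁅e ρ 0, e ρ 2⁆ = ρ.b13 0 • e ρ 0 + ρ.b13 1 • e ρ 1 + ρ.b13 2 • e ρ 2 ∧
    ⁅e ρ 2, e ρ 1⁆ = ρ.b32 0 • e ρ 0 + ρ.b32 1 • e ρ 1 + ρ.b32 2 • e ρ 2 ∧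
    ⁅e ρ 1, e ρ 0⁆ = -(ρ.b12 0 • e ρ 0 + ρ.b12 1 • e ρ 1 + ρ.b12 2 • e ρ 2) ∧
    ⁅e ρ 2, e ρ 0⁆ = -(ρ.b13 0 • e ρ 0 + ρ.b13 1 • e ρ 1 + ρ.b13 2 • e ρ 2) ∧
    ⁅e ρ 1, e ρ 2⁆ = -(ρ.b32 0 • e ρ 0 + ρ.b32 1 • e ρ 1 + ρ.b32 2 • e ρ 2) := by
  have h := lie_e ρ
  have h1 := h.1.trans (eq_sum ρ ρ.b12)
  have h2 := h.2.1.trans (eq_sum ρ ρ.b13)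
  have h3 := h.2.2.trans (eq_sum ρ ρ.b32)
  refine ⟨h1, h2, h3, ?_, ?_, ?_⟩
  · rw [← lie_skew, h1]; rfl
  · rw [← lie_skew, h2]; rfl
  · rw [← lie_skew, h3]; rfl

set_option maxHeartbeats 2000000 in
theorem yangBaxter_biv (v : Fin 3 → ℝ) : yangBaxter (biv ρ v) = ybCoeff ρ v • vol ρ := by
  obtain ⟨h1, h2, h3, h4, h5, h6⟩ := lie_e_eq ρ
  simp only [yangBaxter, biv, wedge, TensorProduct.tmul_add, TensorProduct.add_tmul,
    TensorProduct.tmul_sub, TensorProduct.sub_tmul,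
    TensorProduct.tmul_smul, ← TensorProduct.smul_tmul', map_add, map_sub, map_smul,
    yangBaxter_tmul, lie_self, h1, h2, h3, h4, h5, h6, TensorProduct.neg_tmul,
    TensorProduct.tmul_neg, TensorProduct.zero_tmul, TensorProduct.tmul_zero, vol, ybCoeff]
  module

theorem lie_vol (x : Alg ρ) : ⁅x, vol ρ⁆ = adTrace ρ (coords ρ x) • vol ρ := by
  obtain ⟨h1, h2, h3, h4, h5, h6⟩ := lie_e_eq ρ
  rw [eq_sum ρ x]
  simp only [vol, wedge, add_lie, smul_lie, TensorProduct.LieModule.lie_tmul_right, lie_add,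
    lie_sub, TensorProduct.tmul_add, TensorProduct.add_tmul,
    TensorProduct.tmul_sub, TensorProduct.tmul_smul,
    ← TensorProduct.smul_tmul', lie_self, h1, h2, h3, h4, h5, h6,
    TensorProduct.neg_tmul, TensorProduct.tmul_neg, TensorProduct.zero_tmul,
    TensorProduct.tmul_zero, adTrace, map_add, map_smul, coords_e, Pi.add_apply, Pi.smul_apply,
    Pi.single_apply, smul_eq_mul]
  simp
  module

theorem vol_ne_zero : vol ρ ≠ 0 := by
  intro h
  have := congrArg (fun t => ((basis ρ).tensorProduct (basis2 ρ)).repr t (0, (1, 2))) h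
  simp [vol, wedge, basis2_repr_tmul] at this

/-- By `yangBaxter_biv` and `lie_vol`, this says that the listed vectors are the coordinates of the
bivectors solving the modified Yang–Baxter equation; all bivectors do if `tr ∘ ad = 0`. -/
theorem mem_rMatrices_iff (v : Fin 3 → ℝ) :
    v ∈ ρ.rMatrices ↔ ∀ x, ybCoeff ρ v * adTrace ρ x = 0 := by
  constructor
  · intro h x
    cases ρ <;>
    simp [Row.rMatrices, ybCoeff, adTrace, Row.b12, Row.b13, Row.b32] at h ⊢ <;> grind
  · intro h
    have h0 := h (Pi.single 0 1)
    have h2 := h (Pi.single 2 1)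
    cases ρ with
    | r3lam lam hlam =>
      have h1 : 1 + lam ≠ 0 := by linarith [hlam.1]
      have h3 : 1 - lam ≠ 0 := by linarith [hlam.2]
      simp [ybCoeff, adTrace, Row.b12, Row.b13, Row.b32] at h2
      have h4 : (1 + lam) * (1 - lam) * (v 1 * v 2) = 0 := by grind
      simpa [h1, h3, Row.rMatrices] using h4
    | r3'lam lam hlam =>
      simp [ybCoeff, adTrace, Row.b12, Row.b13, Row.b32] at h2
      have h4 : v 1 ^ 2 + v 2 ^ 2 = 0 := by grind
      constructor <;> nlinarith [sq_nonneg (v 1), sq_nonneg (v 2)]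
    | _ =>
      simp [Row.rMatrices, ybCoeff, adTrace, Row.b12, Row.b13, Row.b32] at h0 h2 ⊢ <;> grind

theorem isRMatrix_biv_iff (v : Fin 3 → ℝ) : IsRMatrix (biv ρ v) ↔ v ∈ ρ.rMatrices := by
  rw [mem_rMatrices_iff, IsRMatrix, and_iff_right (biv_mem_bivectors ρ v)]
  simp only [yangBaxter_biv, lie_smul, lie_vol, smul_smul, smul_eq_zero, vol_ne_zero, or_false]
  exact Iff.rfl

theorem isRMatrix_iff (r : Alg ρ ⊗[ℝ] Alg ρ) :
    IsRMatrix r ↔ ∃ v ∈ ρ.rMatrices, r = Alg.biv ρ v := by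
  constructor
  · intro h
    obtain ⟨v, rfl⟩ := exists_eq_biv ρ h.1
    exact ⟨v, (isRMatrix_biv_iff ρ v).1 h, rfl⟩
  · rintro ⟨v, hv, rfl⟩
    exact (isRMatrix_biv_iff ρ v).2 hv

/-! ### Coboundary Lie bialgebras and the modified Yang–Baxter equation -/

theorem dualDistrib_biv (ξ η : Module.Dual ℝ (Alg ρ)) (v : Fin 3 → ℝ) :
    TensorProduct.dualDistrib ℝ (Alg ρ) (Alg ρ) (ξ ⊗ₜ η) (biv ρ v) =
      v 0 * (ξ (e ρ 0) * η (e ρ 1) - ξ (e ρ 1) * η (e ρ 0))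
        + v 1 * (ξ (e ρ 0) * η (e ρ 2) - ξ (e ρ 2) * η (e ρ 0))
        + v 2 * (ξ (e ρ 1) * η (e ρ 2) - ξ (e ρ 2) * η (e ρ 1)) := by
  simp [biv, wedge]

theorem dualBracket_coboundary_biv (ξ η : Module.Dual ℝ (Alg ρ)) (v : Fin 3 → ℝ) (i : Fin 3) :
    dualBracket (coboundary (biv ρ v)) ξ η (e ρ i) =
      act ρ (Pi.single i 1) v 0 * (ξ (e ρ 0) * η (e ρ 1) - ξ (e ρ 1) * η (e ρ 0))
        + act ρ (Pi.single i 1) v 1 * (ξ (e ρ 0) * η (e ρ 2) - ξ (e ρ 2) * η (e ρ 0))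
        + act ρ (Pi.single i 1) v 2 * (ξ (e ρ 1) * η (e ρ 2) - ξ (e ρ 2) * η (e ρ 1)) := by
  rw [dualBracket, LinearMap.comp_apply, coboundary_apply, lie_biv, dualDistrib_biv, coords_e]

set_option maxHeartbeats 2000000 in
/-- The Jacobiator of the dual bracket of `δ_r` is the pairing with `x · [[r, r]]`. -/
theorem dual_jacobiator (ξ η ζ : Module.Dual ℝ (Alg ρ)) (v : Fin 3 → ℝ) (i : Fin 3) :
    (dualBracket (coboundary (biv ρ v)) ξ (dualBracket (coboundary (biv ρ v)) η ζ)
      + dualBracket (coboundary (biv ρ v)) η (dualBracket (coboundary (biv ρ v)) ζ ξ)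
      + dualBracket (coboundary (biv ρ v)) ζ (dualBracket (coboundary (biv ρ v)) ξ η)) (e ρ i) =
    ybCoeff ρ v * adTrace ρ (Pi.single i 1) *
      (Matrix.of fun j k : Fin 3 => ![ξ, η, ζ] j (e ρ k)).det := by
  simp only [LinearMap.add_apply, dualBracket_coboundary_biv, Matrix.det_fin_three]
  fin_cases i <;> cases ρ <;>
    simp [act, brk, wedgeCoords, Row.b12, Row.b13, Row.b32, ybCoeff, adTrace] <;> ring

theorem isCocommutator_coboundary_biv_iff (v : Fin 3 → ℝ) :
    IsCocommutator (coboundary (biv ρ v)) ↔ v ∈ ρ.rMatrices := by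
  rw [mem_rMatrices_iff]
  constructor
  · intro h x
    have key : ∀ i : Fin 3, ybCoeff ρ v * adTrace ρ (Pi.single i 1) = 0 := by
      intro i
      have h1 := dual_jacobiator ρ ((basis ρ).coord 0) ((basis ρ).coord 1) ((basis ρ).coord 2) v i
      rw [h.dual_jacobi] at h1
      have h2 : (Matrix.of fun j k : Fin 3 =>
          ![(basis ρ).coord 0, (basis ρ).coord 1, (basis ρ).coord 2] j (e ρ k)).det = 1 := by
        simp [Matrix.det_fin_three]
      rw [h2] at h1
      simpa using h1.symm
    have h0 := key 0
    have h1 := key 1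
    have h2 := key 2
    simp [adTrace] at h0 h1 h2 ⊢
    grind
  · intro h
    refine ⟨fun ξ => ?_, fun ξ η ζ => ?_, coboundary_cocycle _⟩
    · refine (basis ρ).ext fun i => ?_
      rw [basis_apply, dualBracket_coboundary_biv, LinearMap.zero_apply]
      ring
    · refine (basis ρ).ext fun i => ?_
      rw [basis_apply, dual_jacobiator, h, zero_mul, LinearMap.zero_apply]

/-- A coboundary Lie bialgebra structure comes from an `r`-matrix. -/
theorem exists_rMatrix_of_isCoboundaryCocommutator {δ : Alg ρ →ₗ[ℝ] Alg ρ ⊗[ℝ] Alg ρ}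
    (h : IsCoboundaryCocommutator δ) : ∃ v ∈ ρ.rMatrices, δ = coboundary (biv ρ v) := by
  obtain ⟨hδ, r, rfl⟩ := h
  have hskew : ∀ x : Alg ρ, ⁅x, r⁆ ∈ bivectors (Alg ρ) := by
    intro x
    have hc : ∀ (t : Alg ρ ⊗[ℝ] Alg ρ) (i j : Fin 3), TensorProduct.dualDistrib ℝ _ _
        ((basis ρ).coord i ⊗ₜ (basis ρ).coord j) t = (basis2 ρ).repr t (i, j) := by
      intro t i j
      induction t with
      | zero => simp
      | tmul a b => simp [basis2_repr_tmul]
      | add a b ha hb => simp only [map_add, Finsupp.add_apply, ha, hb]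
    have hs : ∀ ξ : Module.Dual ℝ (Alg ρ),
        TensorProduct.dualDistrib ℝ _ _ (ξ ⊗ₜ ξ) ⁅x, r⁆ = 0 := fun ξ =>
      LinearMap.congr_fun (hδ.dual_self ξ) x
    refine mem_bivectors_of_repr ρ fun i j => ?_
    have h1 := hs ((basis ρ).coord i)
    have h2 := hs ((basis ρ).coord j)
    have h3 := hs ((basis ρ).coord i + (basis ρ).coord j)
    simp only [TensorProduct.tmul_add, TensorProduct.add_tmul, map_add, LinearMap.add_apply,
      hc] at h1 h2 h3
    linarith
  obtain ⟨s, hs, hrs⟩ := exists_bivector_coboundary_eq hskew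
  obtain ⟨v, rfl⟩ := exists_eq_biv ρ hs
  rw [hrs] at hδ ⊢
  exact ⟨v, (isCocommutator_coboundary_biv_iff ρ v).1 hδ, rfl⟩

end Alg

/-! ### Real Lie algebras of dimension three -/

namespace ThreeDim

variable {L : Type*} [LieRing L] [LieAlgebra ℝ L]

/-- The vectors `f 0`, `f 1`, `f 2` satisfy the commutation relations of `ρ`. -/
def Relations (ρ : Row) (f : Fin 3 → L) : Prop :=
  ⁅f 0, f 1⁆ = ρ.b12 0 • f 0 + ρ.b12 1 • f 1 + ρ.b12 2 • f 2 ∧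
  ⁅f 0, f 2⁆ = ρ.b13 0 • f 0 + ρ.b13 1 • f 1 + ρ.b13 2 • f 2 ∧
  ⁅f 2, f 1⁆ = ρ.b32 0 • f 0 + ρ.b32 1 • f 1 + ρ.b32 2 • f 2

theorem exists_equiv_of_relations {ρ : Row} (b : Module.Basis (Fin 3) ℝ L)
    (h : Relations ρ b) : ∃ T : Alg ρ ≃ₗ⁅ℝ⁆ L, ∀ i, T (Alg.e ρ i) = b i := by
  obtain ⟨h01, h02, h21⟩ := h
  let F : Alg ρ ≃ₗ[ℝ] L := (Alg.coords ρ).trans b.equivFun.symm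
  have hF : ∀ u, F u = Alg.coords ρ u 0 • b 0 + Alg.coords ρ u 1 • b 1
      + Alg.coords ρ u 2 • b 2 := by
    intro u
    simp [F, Module.Basis.equivFun_symm_apply, Fin.sum_univ_three]
  have h10 : ⁅b 1, b 0⁆ = -⁅b 0, b 1⁆ := (lie_skew _ _).symm
  have h20 : ⁅b 2, b 0⁆ = -⁅b 0, b 2⁆ := (lie_skew _ _).symm
  have h12 : ⁅b 1, b 2⁆ = -⁅b 2, b 1⁆ := (lie_skew _ _).symm
  refine ⟨{ F with
    map_lie' := ?_ }, ?_⟩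
  · intro u v
    change F ⁅u, v⁆ = ⁅F u, F v⁆
    simp only [hF, Alg.coords_lie, Alg.brk, add_lie, lie_add, smul_lie, lie_smul, lie_self,
      h10, h20, h12, h01, h02, h21, Pi.add_apply, Pi.smul_apply, smul_eq_mul]
    module
  · intro i
    change F (Alg.e ρ i) = b i
    rw [hF, Alg.coords_e]
    fin_cases i <;> simp

theorem exists_basis_of_det_ne_zero (b : Module.Basis (Fin 3) ℝ L) (f : Fin 3 → L)
    (h : (b.toMatrix f).det ≠ 0) : ∃ c : Module.Basis (Fin 3) ℝ L, ⇑c = f := by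
  have h1 := (Module.Basis.is_basis_iff_det b (v := f)).2
    (by rw [Module.Basis.det_apply]; exact h.isUnit)
  exact ⟨Module.Basis.mk h1.1 h1.2.ge, Module.Basis.coe_mk _ _⟩

/-- A change of basis by an explicit matrix `A`, whose rows are the coordinates of the new basis
vectors. -/
theorem exists_basis_of_matrix (b : Module.Basis (Fin 3) ℝ L) (A : Matrix (Fin 3) (Fin 3) ℝ)
    (h : A.det ≠ 0) : ∃ c : Module.Basis (Fin 3) ℝ L,
      ∀ i, c i = A i 0 • b 0 + A i 1 • b 1 + A i 2 • b 2 := by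
  obtain ⟨c, hc⟩ := exists_basis_of_det_ne_zero b
    (fun i => A i 0 • b 0 + A i 1 • b 1 + A i 2 • b 2) (by
      rw [← Matrix.det_transpose]
      convert h
      ext i j
      fin_cases j <;> simp [Module.Basis.toMatrix_apply])
  exact ⟨c, fun i => by rw [hc]⟩

theorem exists_equiv_of_matrix {ρ : Row} (b : Module.Basis (Fin 3) ℝ L)
    (A : Matrix (Fin 3) (Fin 3) ℝ) (h : A.det ≠ 0)
    (hr : Relations ρ fun i => A i 0 • b 0 + A i 1 • b 1 + A i 2 • b 2) :
    Nonempty (L ≃ₗ⁅ℝ⁆ Alg ρ) := by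
  obtain ⟨c, hc⟩ := exists_basis_of_matrix b A h
  obtain ⟨T, -⟩ := exists_equiv_of_relations (ρ := ρ) c (by rwa [funext hc])
  exact ⟨T.symm⟩

/-! ### The non-unimodular case -/

/-- `x ↦ tr (ad x)`. -/
def traceAd (L : Type*) [LieRing L] [LieAlgebra ℝ L] : L →ₗ[ℝ] ℝ :=
  LinearMap.trace ℝ L ∘ₗ (LieAlgebra.ad ℝ L : L →ₗ[ℝ] Module.End ℝ L)

theorem traceAd_lie (x y : L) : traceAd L ⁅x, y⁆ = 0 := by
  simp [traceAd, LieRing.of_associative_ring_bracket,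
    LinearMap.trace_mul_comm ℝ (LieAlgebra.ad ℝ L x)]

theorem traceAd_eq (b : Module.Basis (Fin 3) ℝ L) (x : L) :
    traceAd L x = b.repr ⁅x, b 0⁆ 0 + b.repr ⁅x, b 1⁆ 1 + b.repr ⁅x, b 2⁆ 2 := by
  simp [traceAd, LinearMap.trace_eq_matrix_trace ℝ b, Matrix.trace, Fin.sum_univ_three,
    LinearMap.toMatrix_apply]

/-- In the non-unimodular case the kernel of `tr ∘ ad` is an abelian ideal, on which some
`b 2` acts with trace `1`. -/
theorem exists_basis_of_traceAd_ne_zero (hL : Module.finrank ℝ L = 3) (ht : traceAd L ≠ 0) :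
    ∃ (b : Module.Basis (Fin 3) ℝ L) (p q r s : ℝ), p + s = 1 ∧ ⁅b 0, b 1⁆ = 0 ∧
      ⁅b 2, b 0⁆ = p • b 0 + q • b 1 ∧ ⁅b 2, b 1⁆ = r • b 0 + s • b 1 := by
  have : FiniteDimensional ℝ L := Module.finite_of_finrank_eq_succ hL
  obtain ⟨x, hx⟩ : ∃ x, traceAd L x = 1 := by
    obtain ⟨x, hx⟩ : ∃ x, traceAd L x ≠ 0 := by
      by_contra! h
      exact ht (LinearMap.ext h)
    exact ⟨(traceAd L x)⁻¹ • x, by simp [hx]⟩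
  have hK : Module.finrank ℝ (LinearMap.ker (traceAd L)) = 2 := by
    have h1 := LinearMap.finrank_range_add_finrank_ker (traceAd L)
    rw [LinearMap.range_eq_top.2 (LinearMap.surjective ht), finrank_top, Module.finrank_self] at h1
    omega
  let k := Module.finBasisOfFinrankEq ℝ (LinearMap.ker (traceAd L)) hK
  have hk : ∀ i, traceAd L (k i : L) = 0 := fun i => (k i).2
  have hli : LinearIndependent ℝ ![(k 0 : L), k 1, x] := by
    rw [Fintype.linearIndependent_iff]
    intro g hg
    rw [Fin.sum_univ_three] at hg
    simp at hg
    have h2 : g 2 = 0 := by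
      have := congrArg (traceAd L) hg
      simpa [hk, hx] using this
    have h01 := Fintype.linearIndependent_iff.1 k.linearIndependent ![g 0, g 1] (by
      apply Subtype.ext
      simpa [h2] using hg)
    intro i
    fin_cases i
    · simpa using h01 0
    · simpa using h01 1
    · exact h2
  let b : Module.Basis (Fin 3) ℝ L :=
    basisOfLinearIndependentOfCardEqFinrank hli (by simp [hL])
  have hb : ⇑b = ![(k 0 : L), k 1, x] := coe_basisOfLinearIndependentOfCardEqFinrank _ _
  have hb0 : b 0 = k 0 := by simp [hb]
  have hb1 : b 1 = k 1 := by simp [hb]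
  have hb2 : b 2 = x := by simp [hb]
  -- the `b 2`-coordinate of an element is the value of `tr ∘ ad` on it
  have hcoord : ∀ y, b.repr y 2 = traceAd L y := by
    intro y
    conv_rhs => rw [← b.sum_repr y, Fin.sum_univ_three, hb0, hb1, hb2]
    simp [hk, hx]
  -- commutators have trace zero, so the derived algebra lies in the kernel
  have hexp : ∀ y z : L, ⁅y, z⁆ = b.repr ⁅y, z⁆ 0 • b 0 + b.repr ⁅y, z⁆ 1 • b 1 := by
    intro y z
    conv_lhs => rw [← b.sum_repr ⁅y, z⁆, Fin.sum_univ_three, hcoord, traceAd_lie]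
    simp
  -- `tr (ad (b 0)) = tr (ad (b 1)) = 0` kills both coordinates of `[b 0, b 1]`
  have h0 := traceAd_eq b (b 0)
  have h1 := traceAd_eq b (b 1)
  have h2 := traceAd_eq b (b 2)
  have h10 : ⁅b 1, b 0⁆ = -⁅b 0, b 1⁆ := (lie_skew _ _).symm
  simp only [hcoord, traceAd_lie, hb0, hb1, hb2, hk, hx, lie_self] at h0 h1 h2
  rw [← hb0, ← hb1] at h0 h1
  rw [h10, map_neg, Finsupp.neg_apply] at h1
  simp only [map_zero, Finsupp.zero_apply, zero_add, add_zero] at h0 h1 h2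
  refine ⟨b, _, _, _, _, ?_, ?_, hexp _ _, hexp _ _⟩
  · rw [hb0, hb1, hb2]; linarith
  · rw [hexp, ← h0, show b.repr ⁅b 0, b 1⁆ 0 = 0 by linarith]; simp

theorem classification_of_traceAd_ne_zero (hL : Module.finrank ℝ L = 3) (ht : traceAd L ≠ 0) :
    ∃ ρ : Row, Nonempty (L ≃ₗ⁅ℝ⁆ Alg ρ) := by
  obtain ⟨b, p, q, r, s, hps, h01, h20, h21⟩ := exists_basis_of_traceAd_ne_zero hL ht
  have h02 : ⁅b 0, b 2⁆ = -⁅b 2, b 0⁆ := (lie_skew _ _).symm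
  have h12 : ⁅b 1, b 2⁆ = -⁅b 2, b 1⁆ := (lie_skew _ _).symm
  have h10 : ⁅b 1, b 0⁆ = -⁅b 0, b 1⁆ := (lie_skew _ _).symm
  by_cases hscal : q = 0 ∧ r = 0 ∧ p = s
  · obtain ⟨rfl, rfl, rfl⟩ := hscal
    obtain rfl : p = 1 / 2 := by linarith
    refine ⟨.r3one, exists_equiv_of_matrix b !![0, 0, 2; 1, 0, 0; 0, 1, 0]
      (by simp [Matrix.det_fin_three]) ?_⟩
    simp [Relations, Row.b12, Row.b13, Row.b32, h20, h21, h10, h01, smul_smul]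
  -- otherwise `k` and `[b 2, k]` are linearly independent for some `k` in the ideal, and in this
  -- basis `b 2` acts by the companion matrix of trace `1` and determinant `D`
  · obtain ⟨c, D, hc01, hc20, hc21⟩ : ∃ (c : Module.Basis (Fin 3) ℝ L) (D : ℝ), ⁅c 0, c 1⁆ = 0 ∧
        ⁅c 2, c 0⁆ = c 1 ∧ ⁅c 2, c 1⁆ = c 1 - D • c 0 := by
      obtain ⟨t, u, htu⟩ : ∃ t u : ℝ, t * (t * q + u * s) - u * (t * p + u * r) ≠ 0 := by
        by_contra! h
        have h1 := h 1 0
        have h2 := h 0 1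
        have h3 := h 1 1
        simp at h1 h2 h3
        refine hscal ⟨h1, h2, ?_⟩
        simp [h1, h2] at h3
        linarith
      obtain ⟨c, hc⟩ := exists_basis_of_matrix b
        !![t, u, 0; t * p + u * r, t * q + u * s, 0; 0, 0, 1]
        (by simpa [Matrix.det_fin_three] using htu)
      have hc0 := hc 0
      have hc1 := hc 1
      have hc2 := hc 2
      simp at hc0 hc1 hc2
      obtain rfl : s = 1 - p := by linarith
      refine ⟨c, p * (1 - p) - q * r, ?_, ?_, ?_⟩
      · simp [hc0, hc1, h01, h10]
      · simp only [hc0, hc1, hc2, lie_add, lie_smul, h20, h21]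
        module
      · simp only [hc0, hc1, hc2, lie_add, lie_smul, h20, h21]
        module
    have hc02 : ⁅c 0, c 2⁆ = -⁅c 2, c 0⁆ := (lie_skew _ _).symm
    have hc12 : ⁅c 1, c 2⁆ = -⁅c 2, c 1⁆ := (lie_skew _ _).symm
    have hc10 : ⁅c 1, c 0⁆ = -⁅c 0, c 1⁆ := (lie_skew _ _).symm
    rcases lt_trichotomy D (1 / 4) with hD | hD | hD
    -- distinct real eigenvalues `m > 1 - m`
    · obtain ⟨m, hm, hmD⟩ : ∃ m : ℝ, 1 / 2 < m ∧ D = m * (1 - m) := by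
        have h1 : 0 < Real.sqrt (1 / 4 - D) := Real.sqrt_pos.2 (by linarith)
        have h2 := Real.sq_sqrt (show 0 ≤ 1 / 4 - D by linarith)
        exact ⟨1 / 2 + Real.sqrt (1 / 4 - D), by linarith, by nlinarith⟩
      have hm0 : 0 < m := by linarith
      refine ⟨.r3lam ((1 - m) / m) ⟨by rw [lt_div_iff₀ hm0]; linarith,
        by rw [div_lt_iff₀ hm0]; linarith⟩, exists_equiv_of_matrix c
        !![-(1 - m), 1, 0; -m, 1, 0; 0, 0, m⁻¹] ?_ ?_⟩
      · simp [Matrix.det_fin_three]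
        field_simp
        intro h
        linarith
      · simp only [Relations, Row.b12, Row.b13, Row.b32]
        simp [hc20, hc21, hc10, hc01, hc02, hc12, smul_smul]
        subst hmD
        refine ⟨?_, ?_⟩ <;> match_scalars <;> field_simp <;> ring
    · subst hD
      refine ⟨.r3, exists_equiv_of_matrix c !![-1, 2, 0; 1, 0, 0; 0, 0, 2] ?_ ?_⟩
      · simp [Matrix.det_fin_three]
      · simp only [Relations, Row.b12, Row.b13, Row.b32]
        simp [hc20, hc21, hc10, hc01, hc02, hc12, smul_smul]
        module
    -- complex eigenvalues `1 / 2 ± i w`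
    · obtain ⟨w, hw, hwD⟩ : ∃ w : ℝ, 0 < w ∧ D = w ^ 2 + 1 / 4 := by
        have h1 : 0 < Real.sqrt (D - 1 / 4) := Real.sqrt_pos.2 (by linarith)
        have h2 := Real.sq_sqrt (show 0 ≤ D - 1 / 4 by linarith)
        exact ⟨_, h1, by linarith⟩
      refine ⟨.r3'lam (1 / (2 * w)) (by positivity), exists_equiv_of_matrix c
        !![1, 0, 0; 1 / (2 * w), -w⁻¹, 0; 0, 0, w⁻¹] ?_ ?_⟩
      · simp [Matrix.det_fin_three, hw.ne']
      · simp only [Relations, Row.b12, Row.b13, Row.b32]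
        simp [hc20, hc21, hc01, hc02, smul_smul]
        subst hwD
        match_scalars <;> field_simp <;> ring

/-! ### The unimodular case -/

/-- `L` has a basis with `[b 1, b 2] = n 0 • b 0` and its cyclic analogues. -/
def HasDiagonalBasis (L : Type*) [LieRing L] [LieAlgebra ℝ L] (n₀ n₁ n₂ : ℝ) : Prop :=
  ∃ b : Module.Basis (Fin 3) ℝ L,
    ⁅b 1, b 2⁆ = n₀ • b 0 ∧ ⁅b 2, b 0⁆ = n₁ • b 1 ∧ ⁅b 0, b 1⁆ = n₂ • b 2

theorem HasDiagonalBasis.rotate {n₀ n₁ n₂ : ℝ} (h : HasDiagonalBasis L n₀ n₁ n₂) :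
    HasDiagonalBasis L n₁ n₂ n₀ := by
  obtain ⟨b, h0, h1, h2⟩ := h
  obtain ⟨c, hc⟩ := exists_basis_of_matrix b !![0, 1, 0; 0, 0, 1; 1, 0, 0]
    (by simp [Matrix.det_fin_three])
  exact ⟨c, by simp [hc, h0, h1, h2]⟩

theorem HasDiagonalBasis.neg {n₀ n₁ n₂ : ℝ} (h : HasDiagonalBasis L n₀ n₁ n₂) :
    HasDiagonalBasis L (-n₀) (-n₁) (-n₂) := by
  obtain ⟨b, h0, h1, h2⟩ := h
  obtain ⟨c, hc⟩ := exists_basis_of_matrix b !![-1, 0, 0; 0, -1, 0; 0, 0, -1]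
    (by simp [Matrix.det_fin_three])
  exact ⟨c, by simp [hc, h0, h1, h2]⟩

/-- An odd permutation changes all signs, so `-b` is permuted in place of `b`. -/
theorem HasDiagonalBasis.swap {n₀ n₁ n₂ : ℝ} (h : HasDiagonalBasis L n₀ n₁ n₂) :
    HasDiagonalBasis L n₁ n₀ n₂ := by
  obtain ⟨b, h0, h1, h2⟩ := h.neg
  have h0' : ⁅b 2, b 1⁆ = n₀ • b 0 := by rw [← lie_skew, h0]; simp
  have h1' : ⁅b 0, b 2⁆ = n₁ • b 1 := by rw [← lie_skew, h1]; simp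
  have h2' : ⁅b 1, b 0⁆ = n₂ • b 2 := by rw [← lie_skew, h2]; simp
  obtain ⟨c, hc⟩ := exists_basis_of_matrix b !![0, 1, 0; 1, 0, 0; 0, 0, 1]
    (by simp [Matrix.det_fin_three])
  exact ⟨c, by simp [hc, h0', h1', h2']⟩

/-- Rescaling the basis vectors replaces the structure constants by their signs. -/
theorem HasDiagonalBasis.normalize {n₀ n₁ n₂ : ℝ} (h : HasDiagonalBasis L n₀ n₁ n₂) :
    HasDiagonalBasis L (SignType.sign n₀) (SignType.sign n₁) (SignType.sign n₂) := by
  have key : ∀ n : ℝ, ∃ m : ℝ, 0 < m ∧ n = SignType.sign n * m ^ 2 := by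
    intro n
    by_cases hn : n = 0
    · exact ⟨1, one_pos, by simp [hn]⟩
    · refine ⟨Real.sqrt |n|, Real.sqrt_pos.2 (abs_pos.2 hn), ?_⟩
      rw [Real.sq_sqrt (abs_nonneg n), sign_mul_abs]
  obtain ⟨b, h0, h1, h2⟩ := h
  obtain ⟨m₀, hm₀, e₀⟩ := key n₀
  obtain ⟨m₁, hm₁, e₁⟩ := key n₁
  obtain ⟨m₂, hm₂, e₂⟩ := key n₂
  rw [e₀] at h0
  rw [e₁] at h1
  rw [e₂] at h2
  obtain ⟨c, hc⟩ := exists_basis_of_matrix b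
    !![(m₁ * m₂)⁻¹, 0, 0; 0, (m₂ * m₀)⁻¹, 0; 0, 0, (m₀ * m₁)⁻¹]
    (by simp [Matrix.det_fin_three, hm₀.ne', hm₁.ne', hm₂.ne'])
  refine ⟨c, ?_⟩
  simp only [hc]
  simp [h0, h1, h2, smul_smul]
  refine ⟨?_, ?_, ?_⟩ <;> congr 1 <;> field_simp

/-- For `tr ∘ ad = 0` the bracket is `[b_j, b_k] = N b_i` for `(i, j, k)` cyclic, with `N`
symmetric. An orthonormal eigenbasis of `N` diagonalises the bracket, since the cross product of
two columns of an orthogonal matrix is `±` the third. -/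
theorem hasDiagonalBasis_of_traceAd_eq_zero (hL : Module.finrank ℝ L = 3) (ht : traceAd L = 0) :
    ∃ n₀ n₁ n₂, HasDiagonalBasis L n₀ n₁ n₂ := by
  have : FiniteDimensional ℝ L := Module.finite_of_finrank_eq_succ hL
  let b := Module.finBasisOfFinrankEq ℝ L hL
  let N : Matrix (Fin 3) (Fin 3) ℝ :=
    Matrix.of ![b.repr ⁅b 1, b 2⁆, b.repr ⁅b 2, b 0⁆, b.repr ⁅b 0, b 1⁆]
  have h10 : ⁅b 1, b 0⁆ = -⁅b 0, b 1⁆ := (lie_skew _ _).symm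
  have h21 : ⁅b 2, b 1⁆ = -⁅b 1, b 2⁆ := (lie_skew _ _).symm
  have h02 : ⁅b 0, b 2⁆ = -⁅b 2, b 0⁆ := (lie_skew _ _).symm
  have hN : N.IsHermitian := by
    have h0 := traceAd_eq b (b 0)
    have h1 := traceAd_eq b (b 1)
    have h2 := traceAd_eq b (b 2)
    simp only [ht, h10, h21, h02, lie_self, map_neg, map_zero, Finsupp.neg_apply,
      Finsupp.zero_apply, LinearMap.zero_apply] at h0 h1 h2
    ext i j
    fin_cases i <;> fin_cases j <;> simp [N] <;> linarith
  -- the columns of `P` are an orthonormal basis of eigenvectors of `N`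
  obtain ⟨P, d, hPP, hNP⟩ : ∃ (P : Matrix (Fin 3) (Fin 3) ℝ) (d : Fin 3 → ℝ),
      P.transpose * P = 1 ∧ ∀ i j, (N * P) i j = d j * P i j := by
    refine ⟨hN.eigenvectorUnitary, hN.eigenvalues, ?_, fun i j => ?_⟩
    · exact (Matrix.mem_unitaryGroup_iff'.1 hN.eigenvectorUnitary.2)
    · have := congrFun (hN.mulVec_eigenvectorBasis j) i
      simpa [Matrix.mulVec, dotProduct, Matrix.mul_apply] using this
  have hdet : P.det ≠ 0 := fun h0 => by
    have := congrArg Matrix.det hPP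
    simp [h0] at this
  -- the entries of the adjugate are those of the cross products of the columns of `P`
  have hadj : P.adjugate = P.det • P.transpose := by
    rw [← mul_one P.adjugate, ← mul_eq_one_comm.1 hPP, ← mul_assoc, Matrix.adjugate_mul]
    simp
  obtain ⟨c, hc⟩ := exists_basis_of_matrix b P.transpose (by rwa [Matrix.det_transpose])
  have hexp : ∀ y, y = b.repr y 0 • b 0 + b.repr y 1 • b 1 + b.repr y 2 • b 2 := fun y => by
    conv_lhs => rw [← b.sum_repr y, Fin.sum_univ_three]
  have e0 : ⁅b 1, b 2⁆ = N 0 0 • b 0 + N 0 1 • b 1 + N 0 2 • b 2 := hexp _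
  have e1 : ⁅b 2, b 0⁆ = N 0 1 • b 0 + N 1 1 • b 1 + N 1 2 • b 2 := by
    rw [← hN.apply 0 1]; exact hexp _
  have e2 : ⁅b 0, b 1⁆ = N 0 2 • b 0 + N 1 2 • b 1 + N 2 2 • b 2 := by
    rw [← hN.apply 0 2, ← hN.apply 1 2]; exact hexp _
  have hs10 : N 1 0 = N 0 1 := by simpa using (hN.apply 0 1)
  have hs20 : N 2 0 = N 0 2 := by simpa using (hN.apply 0 2)
  have hs21 : N 2 1 = N 1 2 := by simpa using (hN.apply 1 2)
  clear_value N
  simp only [Matrix.mul_apply, Fin.sum_univ_three] at hNP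
  have hA : ∀ i j, P.adjugate i j = P.det * P j i := fun i j => by rw [hadj]; simp
  have hA0 := fun j => hA 0 j
  have hA1 := fun j => hA 1 j
  have hA2 := fun j => hA 2 j
  simp only [Matrix.adjugate_fin_three, Fin.forall_fin_succ, IsEmpty.forall_iff,
    and_true] at hA0 hA1 hA2
  simp at hA0 hA1 hA2
  have hN0 := hNP 0
  have hN1 := hNP 1
  have hN2 := hNP 2
  simp only [hs10, hs20, hs21] at hN0 hN1 hN2
  obtain ⟨a00, a01, a02⟩ := hA0
  obtain ⟨a10, a11, a12⟩ := hA1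
  obtain ⟨a20, a21, a22⟩ := hA2
  refine ⟨P.det * d 0, P.det * d 1, P.det * d 2, c, ?_, ?_, ?_⟩
  all_goals
    simp only [hc, lie_add, add_lie, smul_lie, lie_smul, lie_self, h10, h21, h02, e0, e1, e2,
      Matrix.transpose_apply]
    match_scalars
  · linear_combination N 0 0 * a00 + N 0 1 * a01 + N 0 2 * a02 + P.det * hN0 0
  · linear_combination N 0 1 * a00 + N 1 1 * a01 + N 1 2 * a02 + P.det * hN1 0
  · linear_combination N 0 2 * a00 + N 1 2 * a01 + N 2 2 * a02 + P.det * hN2 0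
  · linear_combination N 0 0 * a10 + N 0 1 * a11 + N 0 2 * a12 + P.det * hN0 1
  · linear_combination N 0 1 * a10 + N 1 1 * a11 + N 1 2 * a12 + P.det * hN1 1
  · linear_combination N 0 2 * a10 + N 1 2 * a11 + N 2 2 * a12 + P.det * hN2 1
  · linear_combination N 0 0 * a20 + N 0 1 * a21 + N 0 2 * a22 + P.det * hN0 2
  · linear_combination N 0 1 * a20 + N 1 1 * a21 + N 1 2 * a22 + P.det * hN1 2
  · linear_combination N 0 2 * a20 + N 1 2 * a21 + N 2 2 * a22 + P.det * hN2 2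

theorem classification_of_hasDiagonalBasis {n₀ n₁ n₂ : ℝ} (h : HasDiagonalBasis L n₀ n₁ n₂) :
    IsLieAbelian L ∨ ∃ ρ : Row, Nonempty (L ≃ₗ⁅ℝ⁆ Alg ρ) := by
  have h000 : HasDiagonalBasis L 0 0 0 → IsLieAbelian L := by
    rintro ⟨b, h0, h1, h2⟩
    have h10 : ⁅b 1, b 0⁆ = -⁅b 0, b 1⁆ := (lie_skew _ _).symm
    have h21 : ⁅b 2, b 1⁆ = -⁅b 1, b 2⁆ := (lie_skew _ _).symm
    have h02 : ⁅b 0, b 2⁆ = -⁅b 2, b 0⁆ := (lie_skew _ _).symm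
    refine ⟨fun x y => ?_⟩
    rw [← b.sum_repr x, ← b.sum_repr y, Fin.sum_univ_three, Fin.sum_univ_three]
    simp [h0, h1, h2, h10, h21, h02]
  have h001 : HasDiagonalBasis L 0 0 1 → ∃ ρ : Row, Nonempty (L ≃ₗ⁅ℝ⁆ Alg ρ) := by
    rintro ⟨b, h0, h1, h2⟩
    have h21 : ⁅b 2, b 1⁆ = -⁅b 1, b 2⁆ := (lie_skew _ _).symm
    have h02 : ⁅b 0, b 2⁆ = -⁅b 2, b 0⁆ := (lie_skew _ _).symm
    refine ⟨.h, exists_equiv_of_matrix b 1 (by simp) ?_⟩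
    simp [Relations, Row.b12, Row.b13, Row.b32, h0, h1, h2, h21, h02]
  have h011 : HasDiagonalBasis L 0 (-1) (-1) → ∃ ρ : Row, Nonempty (L ≃ₗ⁅ℝ⁆ Alg ρ) := by
    rintro ⟨b, h0, h1, h2⟩
    have h21 : ⁅b 2, b 1⁆ = -⁅b 1, b 2⁆ := (lie_skew _ _).symm
    have h02 : ⁅b 0, b 2⁆ = -⁅b 2, b 0⁆ := (lie_skew _ _).symm
    refine ⟨.r3'zero, exists_equiv_of_matrix b 1 (by simp) ?_⟩
    simp [Relations, Row.b12, Row.b13, Row.b32, h0, h1, h2, h21, h02]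
  have h01n : HasDiagonalBasis L 0 1 (-1) → ∃ ρ : Row, Nonempty (L ≃ₗ⁅ℝ⁆ Alg ρ) := by
    rintro ⟨b, h0, h1, h2⟩
    have h21 : ⁅b 2, b 1⁆ = -⁅b 1, b 2⁆ := (lie_skew _ _).symm
    have h02 : ⁅b 0, b 2⁆ = -⁅b 2, b 0⁆ := (lie_skew _ _).symm
    -- `b 1 ∓ b 2` are eigenvectors of `ad (b 0)` for the eigenvalues `±1`
    refine ⟨.r3negOne, exists_equiv_of_matrix b !![1, 0, 0; 0, 1, -1; 0, 1 / 2, 1 / 2]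
      (by simp [Matrix.det_fin_three, ← two_mul]) ?_⟩
    simp [Relations, Row.b12, Row.b13, Row.b32, h0, h1, h2, h21, h02]
    refine ⟨?_, ?_⟩ <;> module
  have h111 : HasDiagonalBasis L 1 1 1 → ∃ ρ : Row, Nonempty (L ≃ₗ⁅ℝ⁆ Alg ρ) := by
    rintro ⟨b, h0, h1, h2⟩
    have h21 : ⁅b 2, b 1⁆ = -⁅b 1, b 2⁆ := (lie_skew _ _).symm
    have h02 : ⁅b 0, b 2⁆ = -⁅b 2, b 0⁆ := (lie_skew _ _).symm
    refine ⟨.su2, exists_equiv_of_matrix b 1 (by simp) ?_⟩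
    simp [Relations, Row.b12, Row.b13, Row.b32, h0, h1, h2, h21, h02]
  have h11n : HasDiagonalBasis L 1 1 (-1) → ∃ ρ : Row, Nonempty (L ≃ₗ⁅ℝ⁆ Alg ρ) := by
    rintro ⟨b, h0, h1, h2⟩
    have h21 : ⁅b 2, b 1⁆ = -⁅b 1, b 2⁆ := (lie_skew _ _).symm
    have h02 : ⁅b 0, b 2⁆ = -⁅b 2, b 0⁆ := (lie_skew _ _).symm
    refine ⟨.sl2, exists_equiv_of_matrix b !![1, 0, 0; 0, 1, -1; 0, 1 / 2, 1 / 2]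
      (by simp [Matrix.det_fin_three, ← two_mul]) ?_⟩
    simp [Relations, Row.b12, Row.b13, Row.b32, h0, h1, h2, h21, h02]
    refine ⟨?_, ?_, ?_⟩ <;> module
  -- close the six normal forms under permutations and a common change of sign
  have hn := h.normalize
  have h3 : ∀ s : SignType, s = 0 ∨ s = 1 ∨ s = -1 := by decide
  generalize SignType.sign n₀ = s₀ at hn
  generalize SignType.sign n₁ = s₁ at hn
  generalize SignType.sign n₂ = s₂ at hn
  rcases h3 s₀ with rfl | rfl | rfl <;> rcases h3 s₁ with rfl | rfl | rfl <;>
    rcases h3 s₂ with rfl | rfl | rfl <;>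
    simp only [SignType.coe_zero, SignType.coe_one, SignType.coe_neg_one] at hn <;>
    have hp1 := hn.rotate <;> have hp2 := hn.rotate.rotate <;> have hq := hn.swap <;>
    have hq1 := hn.swap.rotate <;> have hq2 := hn.swap.rotate.rotate <;>
    have hm := hn.neg <;> have hm1 := hp1.neg <;> have hm2 := hp2.neg <;>
    have hr := hq.neg <;> have hr1 := hq1.neg <;> have hr2 := hq2.neg <;>
    (try simp only [neg_neg, neg_zero] at hm hm1 hm2 hr hr1 hr2) <;>
    first
      | exact .inl (h000 (by assumption))
      | exact .inr (h001 (by assumption))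
      | exact .inr (h011 (by assumption))
      | exact .inr (h01n (by assumption))
      | exact .inr (h111 (by assumption))
      | exact .inr (h11n (by assumption))

theorem classification (hL : Module.finrank ℝ L = 3) :
    IsLieAbelian L ∨ ∃ ρ : Row, Nonempty (L ≃ₗ⁅ℝ⁆ Alg ρ) := by
  by_cases ht : traceAd L = 0
  · obtain ⟨n₀, n₁, n₂, h⟩ := hasDiagonalBasis_of_traceAd_eq_zero hL ht
    exact classification_of_hasDiagonalBasis h
  · exact Or.inr (classification_of_traceAd_ne_zero hL ht)

end ThreeDim

namespace Alg

/-! ### Automorphisms in coordinates -/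

/-- The linear map sending the standard basis to the rows of `A` is an automorphism of `Alg ρ`. -/
structure IsAut (ρ : Row) (A : Matrix (Fin 3) (Fin 3) ℝ) : Prop where
  det_ne_zero : A.det ≠ 0
  b12 : brk ρ (A 0) (A 1) = ρ.b12 0 • A 0 + ρ.b12 1 • A 1 + ρ.b12 2 • A 2
  b13 : brk ρ (A 0) (A 2) = ρ.b13 0 • A 0 + ρ.b13 1 • A 1 + ρ.b13 2 • A 2
  b32 : brk ρ (A 2) (A 1) = ρ.b32 0 • A 0 + ρ.b32 1 • A 1 + ρ.b32 2 • A 2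

theorem IsAut.exists_equiv {ρ : Row} {A : Matrix (Fin 3) (Fin 3) ℝ} (h : IsAut ρ A) :
    ∃ T : Alg ρ ≃ₗ⁅ℝ⁆ Alg ρ, ∀ i, coords ρ (T (e ρ i)) = A i := by
  obtain ⟨c, hc⟩ := ThreeDim.exists_basis_of_matrix (basis ρ) A h.det_ne_zero
  have hcA : ∀ i, c i = (coords ρ).symm (A i) := by
    intro i
    rw [hc, eq_sum ρ ((coords ρ).symm (A i))]
    simp only [basis_apply, LinearEquiv.apply_symm_apply]
  obtain ⟨T, hT⟩ := ThreeDim.exists_equiv_of_relations (ρ := ρ) c (by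
    rw [funext hcA]
    exact ⟨h.b12, h.b13, h.b32⟩)
  exact ⟨T, fun i => by rw [hT, hcA, LinearEquiv.apply_symm_apply]⟩

theorem isAut_of_equiv {ρ : Row} (T : Alg ρ ≃ₗ⁅ℝ⁆ Alg ρ) :
    IsAut ρ (Matrix.of fun i => coords ρ (T (e ρ i))) := by
  obtain ⟨h1, h2, h3, -⟩ := lie_e_eq ρ
  refine ⟨?_, ?_, ?_, ?_⟩
  · have := (basis ρ).isUnit_det ((basis ρ).map T.toLinearEquiv)
    rw [Module.Basis.det_apply, ← Matrix.det_transpose] at this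
    convert this.ne_zero
    ext i j
    simp [Module.Basis.toMatrix_apply, basis_apply]
  · have := congrArg (fun x => coords ρ (T x)) h1
    simp only [LieEquiv.map_lie, coords_lie, map_add, map_smul] at this
    exact this
  · have := congrArg (fun x => coords ρ (T x)) h2
    simp only [LieEquiv.map_lie, coords_lie, map_add, map_smul] at this
    exact this
  · have := congrArg (fun x => coords ρ (T x)) h3
    simp only [LieEquiv.map_lie, coords_lie, map_add, map_smul] at this
    exact this

theorem reducedEquiv_biv_iff (ρ : Row) (v w : Fin 3 → ℝ) :
    ReducedEquiv (biv ρ v) (biv ρ w) ↔ ∃ A, IsAut ρ A ∧ extSq A v - w ∈ ρ.invariants := by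
  constructor
  · rintro ⟨T, hT⟩
    refine ⟨_, isAut_of_equiv T, ?_⟩
    rw [tensorSq_biv, ← biv_sub, biv_mem_invariantBivectors_iff] at hT
    exact hT
  · rintro ⟨A, hA, h⟩
    obtain ⟨T, hT⟩ := hA.exists_equiv
    refine ⟨T, ?_⟩
    rw [tensorSq_biv, ← biv_sub, biv_mem_invariantBivectors_iff]
    simpa only [hT] using h

theorem extSq_eq (A : Matrix (Fin 3) (Fin 3) ℝ) (v : Fin 3 → ℝ) :
    extSq A v =
      ![v 0 * (A 0 0 * A 1 1 - A 0 1 * A 1 0) + v 1 * (A 0 0 * A 2 1 - A 0 1 * A 2 0)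
          + v 2 * (A 1 0 * A 2 1 - A 1 1 * A 2 0),
        v 0 * (A 0 0 * A 1 2 - A 0 2 * A 1 0) + v 1 * (A 0 0 * A 2 2 - A 0 2 * A 2 0)
          + v 2 * (A 1 0 * A 2 2 - A 1 2 * A 2 0),
        v 0 * (A 0 1 * A 1 2 - A 0 2 * A 1 1) + v 1 * (A 0 1 * A 2 2 - A 0 2 * A 2 1)
          + v 2 * (A 1 1 * A 2 2 - A 1 2 * A 2 1)] := by
  ext i
  fin_cases i <;> simp [extSq, wedgeCoords]

theorem vec_eq_iff (v : Fin 3 → ℝ) (a b c : ℝ) : v = ![a, b, c] ↔ v 0 = a ∧ v 1 = b ∧ v 2 = c := by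
  simp [funext_iff, Fin.forall_fin_succ]

theorem vec_eq_zero_iff (v : Fin 3 → ℝ) : v = 0 ↔ v 0 = 0 ∧ v 1 = 0 ∧ v 2 = 0 := by
  simp [funext_iff, Fin.forall_fin_succ]

theorem eq_zero_of_extSq_eq_zero {A : Matrix (Fin 3) (Fin 3) ℝ} (hA : A.det ≠ 0) {v : Fin 3 → ℝ}
    (h : extSq A v = 0) : v = 0 := by
  rw [extSq_eq, vec_eq_zero_iff] at h
  simp only [Matrix.cons_val] at h
  obtain ⟨h0, h1, h2⟩ := h
  rw [vec_eq_zero_iff]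
  have e0 : A.det * v 0 = 0 := by
    rw [Matrix.det_fin_three]
    linear_combination A 2 2 * h0 - A 2 1 * h1 + A 2 0 * h2
  have e1 : A.det * v 1 = 0 := by
    rw [Matrix.det_fin_three]
    linear_combination -A 1 2 * h0 + A 1 1 * h1 - A 1 0 * h2
  have e2 : A.det * v 2 = 0 := by
    rw [Matrix.det_fin_three]
    linear_combination A 0 2 * h0 - A 0 1 * h1 + A 0 0 * h2
  simpa [hA] using And.intro e0 (And.intro e1 e2)

theorem reducedEquiv_of_extSq {ρ : Row} {v w : Fin 3 → ℝ} (A : Matrix (Fin 3) (Fin 3) ℝ)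
    (hA : IsAut ρ A) (h : extSq A v = w) : ReducedEquiv (biv ρ v) (biv ρ w) := by
  rw [reducedEquiv_biv_iff]
  refine ⟨A, hA, ?_⟩
  rw [h, sub_self]
  cases ρ <;> simp [Row.invariants]

/-! ### Representatives of the orbits -/

theorem isAut_one (ρ : Row) : IsAut ρ 1 := by
  refine ⟨by simp, ?_, ?_, ?_⟩ <;> ext i <;> fin_cases i <;> simp [brk]

theorem reducedEquiv_zero_of_mem {ρ : Row} {v : Fin 3 → ℝ} (h : v ∈ ρ.invariants) :
    ReducedEquiv (biv ρ v) (biv ρ 0) := by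
  rw [reducedEquiv_biv_iff]
  refine ⟨1, isAut_one ρ, ?_⟩
  convert h
  rw [extSq_eq, sub_zero, eq_comm, vec_eq_iff]
  simp

theorem isAut_h {a : ℝ} (ha : a ≠ 0) : IsAut .h !![a, 0, 0; 0, 1, 0; 0, 0, a] := by
  refine ⟨by simp [Matrix.det_fin_three, ha], ?_, ?_, ?_⟩ <;> ext i <;> fin_cases i <;>
    simp [brk, Row.b12, Row.b13, Row.b32]

theorem isAut_r3'zero {a b : ℝ} (h : a ^ 2 + b ^ 2 ≠ 0) :
    IsAut .r3'zero !![1, 0, 0; 0, a, b; 0, -b, a] := by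
  refine ⟨by simp [Matrix.det_fin_three]; convert h using 1; ring_nf, ?_, ?_, ?_⟩ <;> ext i <;>
    fin_cases i <;> simp [brk, Row.b12, Row.b13, Row.b32]

theorem isAut_r3negOne {a b : ℝ} (ha : a ≠ 0) (hb : b ≠ 0) :
    IsAut .r3negOne !![1, 0, 0; 0, a, 0; 0, 0, b] := by
  refine ⟨by simp [Matrix.det_fin_three, ha, hb], ?_, ?_, ?_⟩ <;> ext i <;>
    fin_cases i <;> simp [brk, Row.b12, Row.b13, Row.b32]

theorem isAut_r3negOne_swap {a : ℝ} (ha : a ≠ 0) :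
    IsAut .r3negOne !![-1, 0, 0; 0, 0, 1; 0, a, 0] := by
  refine ⟨by simp [Matrix.det_fin_three, ha], ?_, ?_, ?_⟩ <;> ext i <;>
    fin_cases i <;> simp [brk, Row.b12, Row.b13, Row.b32]

theorem isAut_r3one {p a b c d : ℝ} (h : a * d - b * c ≠ 0) :
    IsAut .r3one !![1, p, 0; 0, a, b; 0, c, d] := by
  refine ⟨by simpa [Matrix.det_fin_three] using h, ?_, ?_, ?_⟩ <;> ext i <;>
    fin_cases i <;> simp [brk, Row.b12, Row.b13, Row.b32]

theorem isAut_r3 {a q : ℝ} (ha : a ≠ 0) :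
    IsAut .r3 !![a, 0, 0; 0, a, 0; 0, q, 1] := by
  refine ⟨by simp [Matrix.det_fin_three, ha], ?_, ?_, ?_⟩ <;> ext i <;>
    fin_cases i <;> simp [brk, Row.b12, Row.b13, Row.b32]

theorem isAut_r3lam {lam : ℝ} {hlam} {a b p q : ℝ} (ha : a ≠ 0) (hb : b ≠ 0) :
    IsAut (.r3lam lam hlam) !![a, 0, 0; 0, b, 0; p, q, 1] := by
  refine ⟨by simp [Matrix.det_fin_three, ha, hb], ?_, ?_, ?_⟩ <;> ext i <;>
    fin_cases i <;> simp [brk, Row.b12, Row.b13, Row.b32]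
  ring

theorem isAut_r3'lam {lam : ℝ} {hlam} {a : ℝ} (ha : a ≠ 0) :
    IsAut (.r3'lam lam hlam) !![a, 0, 0; 0, a, 0; 0, 0, 1] := by
  refine ⟨by simp [Matrix.det_fin_three, ha], ?_, ?_, ?_⟩ <;> ext i <;>
    fin_cases i <;> simp [brk, Row.b12, Row.b13, Row.b32, mul_comm]

/-- For `m = (z, -y, x)`, the rotation by `π` about `m`; on `Λ²` it is the rotation by `π` about
`n = (x, y, z)`. -/
def rotSu2 (n : Fin 3 → ℝ) (t : ℝ) : Matrix (Fin 3) (Fin 3) ℝ :=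
  !![2 * t * n 2 * n 2 - 1, -2 * t * n 2 * n 1, 2 * t * n 2 * n 0;
    -2 * t * n 1 * n 2, 2 * t * n 1 * n 1 - 1, -2 * t * n 1 * n 0;
    2 * t * n 0 * n 2, -2 * t * n 0 * n 1, 2 * t * n 0 * n 0 - 1]

theorem isAut_rotSu2 {n : Fin 3 → ℝ} {t : ℝ} (ht : t * (n 0 ^ 2 + n 1 ^ 2 + n 2 ^ 2) = 1) :
    IsAut .su2 (rotSu2 n t) := by
  have hd : (rotSu2 n t).det = 1 := by
    simp [Matrix.det_fin_three, rotSu2]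
    linear_combination 2 * ht
  refine ⟨by simp [hd], ?_, ?_, ?_⟩ <;> ext i <;>
    fin_cases i <;> simp [brk, Row.b12, Row.b13, Row.b32, rotSu2] <;> grind

theorem extSq_rotSu2 {n v : Fin 3 → ℝ} {t : ℝ} (ht : t * (n 0 ^ 2 + n 1 ^ 2 + n 2 ^ 2) = 1) :
    extSq (rotSu2 n t) v = (2 * t * (n 0 * v 0 + n 1 * v 1 + n 2 * v 2)) • n - v := by
  rw [extSq_eq, eq_comm, vec_eq_iff]
  simp [rotSu2]
  refine ⟨?_, ?_, ?_⟩ <;> grind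

/-- The rotation by `π` about `n` with respect to the invariant form on `Λ²`. -/
def rotSl2 (n : Fin 3 → ℝ) (t : ℝ) : Matrix (Fin 3) (Fin 3) ℝ :=
  !![2 * t * n 2 * n 2 - 1, 2 * t * n 2 * n 0, -2 * t * n 2 * n 1;
    -2 * t * n 1 * n 2, -2 * t * n 1 * n 0 - 1, 2 * t * n 1 * n 1;
    2 * t * n 0 * n 2, 2 * t * n 0 * n 0, -2 * t * n 0 * n 1 - 1]

theorem isAut_rotSl2 {n : Fin 3 → ℝ} {t : ℝ} (ht : t * (n 2 ^ 2 - 2 * n 0 * n 1) = 1) :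
    IsAut .sl2 (rotSl2 n t) := by
  have hd : (rotSl2 n t).det = 1 := by
    simp [Matrix.det_fin_three, rotSl2]
    linear_combination 2 * ht
  refine ⟨by simp [hd], ?_, ?_, ?_⟩ <;> ext i <;>
    fin_cases i <;> simp [brk, Row.b12, Row.b13, Row.b32, rotSl2] <;> grind

theorem extSq_rotSl2 {n v : Fin 3 → ℝ} {t : ℝ} (ht : t * (n 2 ^ 2 - 2 * n 0 * n 1) = 1) :
    extSq (rotSl2 n t) v = (2 * t * (n 2 * v 2 - n 0 * v 1 - n 1 * v 0)) • n - v := by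
  rw [extSq_eq, eq_comm, vec_eq_iff]
  simp [rotSl2]
  refine ⟨?_, ?_, ?_⟩ <;> grind

/-! ### The orbits consist of equivalent bivectors -/

/-- The rotation by `π` about `v + (a, 0, 0)` exchanges `v` and `(a, 0, 0)`. -/
theorem reducedEquiv_su2 {v : Fin 3 → ℝ} {a : ℝ} (ha : 0 < a)
    (h : v 0 ^ 2 + v 1 ^ 2 + v 2 ^ 2 = a ^ 2) :
    ReducedEquiv (biv .su2 v) (biv .su2 ![a, 0, 0]) := by
  have hQ : (v 0 + a) ^ 2 + v 1 ^ 2 + v 2 ^ 2 = 2 * a * (v 0 + a) := by linear_combination h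
  by_cases h0 : v 0 + a = 0
  · have h1 : v 1 = 0 := by nlinarith [sq_nonneg (v 1), sq_nonneg (v 2)]
    have h2 : v 2 = 0 := by nlinarith [sq_nonneg (v 1), sq_nonneg (v 2)]
    -- the antipode of the representative is moved by the rotation by `π` about `e₁₃`
    refine reducedEquiv_of_extSq _ (isAut_rotSu2 (n := ![0, 1, 0]) (t := 1) (by simp)) ?_
    rw [extSq_rotSu2 (by simp), vec_eq_iff]
    simp [h1, h2]
    linarith
  · have ht : 1 / (2 * a * (v 0 + a)) * ((![v 0 + a, v 1, v 2] : Fin 3 → ℝ) 0 ^ 2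
        + (![v 0 + a, v 1, v 2] : Fin 3 → ℝ) 1 ^ 2
        + (![v 0 + a, v 1, v 2] : Fin 3 → ℝ) 2 ^ 2) = 1 := by
      simp only [Matrix.cons_val]
      rw [hQ]
      field_simp
    refine reducedEquiv_of_extSq _ (isAut_rotSu2 ht) ?_
    have h3 : 2 * (1 / (2 * a * (v 0 + a))) *
        ((v 0 + a) * v 0 + v 1 * v 1 + v 2 * v 2) = 1 := by
      rw [show (v 0 + a) * v 0 + v 1 * v 1 + v 2 * v 2 = a * (v 0 + a) by linear_combination h]
      field_simp
    rw [extSq_rotSu2 ht, vec_eq_iff]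
    simp only [Matrix.cons_val, Pi.sub_apply, Pi.smul_apply, smul_eq_mul, h3]
    simp

/-- Two vectors `v`, `w` of equal norm for the invariant form are exchanged by the rotation by `π`
about `v + w`, unless `v + w` is isotropic. -/
theorem reducedEquiv_sl2_of_add {v w : Fin 3 → ℝ}
    (h : 2 * v 0 * v 1 - v 2 ^ 2 = 2 * w 0 * w 1 - w 2 ^ 2)
    (h0 : (v 2 + w 2) ^ 2 - 2 * (v 0 + w 0) * (v 1 + w 1) ≠ 0) :
    ReducedEquiv (biv .sl2 v) (biv .sl2 w) := by
  have ht : 1 / ((v 2 + w 2) ^ 2 - 2 * (v 0 + w 0) * (v 1 + w 1)) *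
      ((v + w) 2 ^ 2 - 2 * (v + w) 0 * (v + w) 1) = 1 := by
    simp only [Pi.add_apply]
    field_simp
  refine reducedEquiv_of_extSq _ (isAut_rotSl2 ht) ?_
  have h3 : 2 * (1 / ((v 2 + w 2) ^ 2 - 2 * (v 0 + w 0) * (v 1 + w 1))) *
      ((v 2 + w 2) * v 2 - (v 0 + w 0) * v 1 - (v 1 + w 1) * v 0) = 1 := by
    field_simp
    linear_combination -h
  rw [extSq_rotSl2 ht]
  simp only [Pi.add_apply, h3]
  simp

/-- This automorphism acts by `-1` on the bivectors with `x = y`, such as the non-isotropic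
representatives. -/
theorem isAut_sl2_neg : IsAut .sl2 !![-1, 0, 0; 0, 0, 1; 0, 1, 0] := by
  refine ⟨by simp [Matrix.det_fin_three], ?_, ?_, ?_⟩ <;> ext i <;>
    fin_cases i <;> simp [brk, Row.b12, Row.b13, Row.b32]

theorem isAut_sl2_diag {a : ℝ} (ha : a ≠ 0) :
    IsAut .sl2 !![1, 0, 0; 0, a, 0; 0, 0, a⁻¹] := by
  refine ⟨by simp [Matrix.det_fin_three, ha], ?_, ?_, ?_⟩ <;> ext i <;>
    fin_cases i <;> simp [brk, Row.b12, Row.b13, Row.b32, ha]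

/-- If `v + w` is isotropic but `w` is not, then `v` is moved to `-w` first. -/
theorem reducedEquiv_sl2 {v w : Fin 3 → ℝ}
    (h : 2 * v 0 * v 1 - v 2 ^ 2 = 2 * w 0 * w 1 - w 2 ^ 2)
    (hw : 2 * w 0 * w 1 - w 2 ^ 2 ≠ 0) (hneg : w 0 = w 1) :
    ReducedEquiv (biv .sl2 v) (biv .sl2 w) := by
  by_cases h0 : (v 2 + w 2) ^ 2 - 2 * (v 0 + w 0) * (v 1 + w 1) = 0
  · have h1 : ReducedEquiv (biv .sl2 v) (biv .sl2 (-w)) := by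
      refine reducedEquiv_sl2_of_add (by simpa using h) ?_
      simp only [Pi.neg_apply]
      intro h2
      apply hw
      linarith
    refine reducedEquiv_trans h1 (reducedEquiv_of_extSq _ isAut_sl2_neg ?_)
    ext i
    rw [extSq_eq]
    fin_cases i <;> simp [hneg]
  · exact reducedEquiv_sl2_of_add h h0

theorem reducedEquiv_sl2_null {v : Fin 3 → ℝ} (h : 2 * v 0 * v 1 - v 2 ^ 2 = 0) (hv : v ≠ 0) :
    ReducedEquiv (biv .sl2 v) (biv .sl2 ![1, 0, 0]) := by
  by_cases h1 : v 1 = 0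
  · have h2 : v 2 = 0 := by simpa [h1] using h
    have h0 : v 0 ≠ 0 := fun h0 => hv ((vec_eq_zero_iff v).2 ⟨h0, h1, h2⟩)
    refine reducedEquiv_of_extSq _ (isAut_sl2_diag (inv_ne_zero h0)) ?_
    rw [extSq_eq, vec_eq_iff]
    simp [h1, h2, h0]
  · refine reducedEquiv_sl2_of_add (by simpa using h) ?_
    simp
    intro h3
    apply h1
    linarith

theorem reducedEquiv_rep {ρ : Row} {c : OrbitClass} (hc : c ∈ ρ.classes) {v : Fin 3 → ℝ}
    (hv : v ∈ c.orbit) : ReducedEquiv (biv ρ v) (biv ρ c.rep) := by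
  cases ρ with
  | sl2 =>
    rcases hc with ((rfl | rfl) | ⟨k, hk, rfl⟩) | ⟨k, hk, rfl⟩
    · exact reducedEquiv_zero_of_mem hv
    · exact reducedEquiv_sl2_null hv.1 hv.2
    · refine reducedEquiv_sl2 ?_ ?_ ?_
      · simpa using hv
      · simp [hk.ne']
      · simp
    · refine reducedEquiv_sl2 ?_ ?_ ?_
      · simp only [Set.mem_ofPred_eq] at hv
        simp [hv]; ring
      · simp [hk.ne']
      · simp
  | su2 =>
    rcases hc with rfl | ⟨a, ha, rfl⟩
    · exact reducedEquiv_zero_of_mem hv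
    · exact reducedEquiv_su2 ha hv
  | h =>
    rcases hc with rfl | rfl
    · exact reducedEquiv_zero_of_mem hv
    · rw [reducedEquiv_biv_iff]
      refine ⟨_, isAut_h (inv_ne_zero hv), ?_⟩
      have hv' : v 0 ≠ 0 := hv
      simp [Row.invariants, extSq_eq, hv']
  | r3'zero =>
    rcases hc with rfl | rfl
    · exact reducedEquiv_zero_of_mem hv
    · have hv' : v 0 ^ 2 + v 1 ^ 2 ≠ 0 := ne_of_gt hv
      rw [reducedEquiv_biv_iff]
      refine ⟨_, isAut_r3'zero (a := v 0 / (v 0 ^ 2 + v 1 ^ 2)) (b := -v 1 / (v 0 ^ 2 + v 1 ^ 2))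
        ?_, ?_⟩
      · field_simp
        simpa using hv'
      · simp [Row.invariants, extSq_eq]
        constructor <;> field_simp <;> ring
  | r3negOne =>
    rcases hc with rfl | rfl | rfl
    · exact reducedEquiv_zero_of_mem hv
    · obtain ⟨h1, h2⟩ := hv
      rw [reducedEquiv_biv_iff]
      by_cases h0 : v 0 = 0
      · have h3 : v 1 ≠ 0 := by simpa [h0] using h2
        refine ⟨_, isAut_r3negOne_swap (a := -(v 1)⁻¹) (by simpa using h3), ?_⟩
        simp [Row.invariants, extSq_eq, h0, h3]
      · have h3 : v 1 = 0 := by simpa [h0] using h1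
        refine ⟨_, isAut_r3negOne (inv_ne_zero h0) one_ne_zero, ?_⟩
        simp [Row.invariants, extSq_eq, h0, h3]
    · have h0 : v 0 ≠ 0 := left_ne_zero_of_mul hv
      have h1 : v 1 ≠ 0 := right_ne_zero_of_mul hv
      rw [reducedEquiv_biv_iff]
      refine ⟨_, isAut_r3negOne (inv_ne_zero h0) (inv_ne_zero h1), ?_⟩
      simp [Row.invariants, extSq_eq, h0, h1]
  | r3one =>
    rcases hc with rfl | rfl | rfl
    · exact reducedEquiv_zero_of_mem hv
    · have hv' : v 0 ^ 2 + v 1 ^ 2 ≠ 0 := hv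
      refine reducedEquiv_of_extSq _ (isAut_r3one (p := -v 2 / (v 0 ^ 2 + v 1 ^ 2))
        (a := v 1 / (v 0 ^ 2 + v 1 ^ 2)) (b := v 0 / (v 0 ^ 2 + v 1 ^ 2))
        (c := -v 0 / (v 0 ^ 2 + v 1 ^ 2)) (d := v 1 / (v 0 ^ 2 + v 1 ^ 2)) ?_) ?_
      · rw [show v 1 / (v 0 ^ 2 + v 1 ^ 2) * (v 1 / (v 0 ^ 2 + v 1 ^ 2))
            - v 0 / (v 0 ^ 2 + v 1 ^ 2) * (-v 0 / (v 0 ^ 2 + v 1 ^ 2))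
            = 1 / (v 0 ^ 2 + v 1 ^ 2) by field_simp; ring]
        exact one_div_ne_zero hv'
      · rw [extSq_eq, vec_eq_iff]
        simp
        refine ⟨?_, ?_, ?_⟩ <;> field_simp <;> ring
    · obtain ⟨h0, h1, h2⟩ := hv
      refine reducedEquiv_of_extSq _ (isAut_r3one (p := 0) (a := (v 2)⁻¹) (b := 0) (c := 0)
        (d := 1) (by simpa using h2)) ?_
      rw [extSq_eq, vec_eq_iff]
      simp [h0, h1, h2]
  | r3 =>
    rcases hc with rfl | rfl | rfl | rfl
    · exact reducedEquiv_zero_of_mem hv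
    · obtain ⟨h0, h1, h2⟩ := hv
      have hs := Real.mul_self_sqrt h0.le
      have hs0 := (Real.sqrt_pos.2 h0).ne'
      refine reducedEquiv_of_extSq _ (isAut_r3 (a := (√(v 0))⁻¹) (q := 0) (inv_ne_zero hs0)) ?_
      rw [extSq_eq, vec_eq_iff]
      simp [h1, h2]
      field_simp
      linarith
    · obtain ⟨h0, h1, h2⟩ := hv
      have h0' : 0 < -v 0 := by linarith
      have hs := Real.mul_self_sqrt h0'.le
      have hs0 := (Real.sqrt_pos.2 h0').ne'
      refine reducedEquiv_of_extSq _ (isAut_r3 (a := (√(-v 0))⁻¹) (q := 0) (inv_ne_zero hs0)) ?_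
      rw [extSq_eq, vec_eq_iff]
      simp [h1, h2]
      field_simp
      linarith
    · obtain ⟨h1, h2⟩ := hv
      refine reducedEquiv_of_extSq _ (isAut_r3 (a := (v 1)⁻¹) (q := -v 0 / v 1 ^ 2)
        (inv_ne_zero h1)) ?_
      rw [extSq_eq, vec_eq_iff]
      simp [h1, h2]
      field_simp
      ring
  | r3lam lam hlam =>
    rcases hc with rfl | rfl | rfl | rfl
    · exact reducedEquiv_zero_of_mem hv
    · obtain ⟨h1, h2⟩ := hv
      refine reducedEquiv_of_extSq _ (isAut_r3lam (a := 1) (b := (v 2)⁻¹) (p := v 0 / v 2)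
        (q := 0) one_ne_zero (inv_ne_zero h2)) ?_
      rw [extSq_eq, vec_eq_iff]
      simp [h1, h2]
      field_simp
      ring
    · obtain ⟨h2, h1⟩ := hv
      refine reducedEquiv_of_extSq _ (isAut_r3lam (a := (v 1)⁻¹) (b := 1) (q := -v 0 / v 1)
        (p := 0) (inv_ne_zero h1) one_ne_zero) ?_
      rw [extSq_eq, vec_eq_iff]
      simp [h1, h2]
      field_simp
      ring
    · obtain ⟨h0, h1, h2⟩ := hv
      refine reducedEquiv_of_extSq _ (isAut_r3lam (a := (v 0)⁻¹) (b := 1) (q := 0)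
        (p := 0) (inv_ne_zero h0) one_ne_zero) ?_
      rw [extSq_eq, vec_eq_iff]
      simp [h0, h1, h2]
  | r3'lam lam hlam =>
    rcases hc with rfl | rfl | rfl
    · exact reducedEquiv_zero_of_mem hv
    · obtain ⟨h0, h1, h2⟩ := hv
      have hs := Real.mul_self_sqrt h0.le
      have hs0 := (Real.sqrt_pos.2 h0).ne'
      refine reducedEquiv_of_extSq _ (isAut_r3'lam (a := (√(v 0))⁻¹) (inv_ne_zero hs0)) ?_
      rw [extSq_eq, vec_eq_iff]
      simp [h1, h2]
      field_simp
      linarith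
    · obtain ⟨h0, h1, h2⟩ := hv
      have h0' : 0 < -v 0 := by linarith
      have hs := Real.mul_self_sqrt h0'.le
      have hs0 := (Real.sqrt_pos.2 h0').ne'
      refine reducedEquiv_of_extSq _ (isAut_r3'lam (a := (√(-v 0))⁻¹) (inv_ne_zero hs0)) ?_
      rw [extSq_eq, vec_eq_iff]
      simp [h1, h2]
      field_simp
      linarith

/-! ### The orbits are closed under equivalence -/

/-- With `[u, v] = N (u × v)`, an automorphism `A` satisfies `A N = N cof A`. Hence its rows are
orthogonal for the form `N⁻¹`, with common scale `det A`; comparing Gram determinants gives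
`det A = 1`, so that `Λ²A = cof A` preserves the form `N`. Here `N = 1`. -/
theorem extSq_su2 {A : Matrix (Fin 3) (Fin 3) ℝ} (hA : IsAut .su2 A) (v : Fin 3 → ℝ) :
    extSq A v 0 ^ 2 + extSq A v 1 ^ 2 + extSq A v 2 ^ 2 = v 0 ^ 2 + v 1 ^ 2 + v 2 ^ 2 := by
  obtain ⟨hd, h1, h2, h3⟩ := hA
  simp [funext_iff, Fin.forall_fin_succ, brk, Row.b12, Row.b13, Row.b32] at h1 h2 h3
  obtain ⟨h10, h11, h12⟩ := h1
  obtain ⟨h20, h21, h22⟩ := h2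
  obtain ⟨h30, h31, h32⟩ := h3
  rw [Matrix.det_fin_three] at hd
  obtain ⟨t, ht⟩ : ∃ t, t = A 0 0 * A 1 1 * A 2 2 - A 0 0 * A 1 2 * A 2 1 - A 0 1 * A 1 0 * A 2 2
    + A 0 1 * A 1 2 * A 2 0 + A 0 2 * A 1 0 * A 2 1 - A 0 2 * A 1 1 * A 2 0 := ⟨_, rfl⟩
  rw [← ht] at hd
  -- invariance of the form turns each Gram entry into a triple product of the rows
  have g00 : A 0 0 ^ 2 + A 0 1 ^ 2 + A 0 2 ^ 2 = t := by grind
  have g11 : A 1 0 ^ 2 + A 1 1 ^ 2 + A 1 2 ^ 2 = t := by grind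
  have g22 : A 2 0 ^ 2 + A 2 1 ^ 2 + A 2 2 ^ 2 = t := by grind
  have g01 : A 0 0 * A 1 0 + A 0 1 * A 1 1 + A 0 2 * A 1 2 = 0 := by grind
  have g02 : A 0 0 * A 2 0 + A 0 1 * A 2 1 + A 0 2 * A 2 2 = 0 := by grind
  have g12 : A 1 0 * A 2 0 + A 1 1 * A 2 1 + A 1 2 * A 2 2 = 0 := by grind
  have ht1 : t = 1 := by
    have h : t ^ 2 = (A 0 0 ^ 2 + A 0 1 ^ 2 + A 0 2 ^ 2) *
        ((A 1 0 ^ 2 + A 1 1 ^ 2 + A 1 2 ^ 2) * (A 2 0 ^ 2 + A 2 1 ^ 2 + A 2 2 ^ 2)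
          - (A 1 0 * A 2 0 + A 1 1 * A 2 1 + A 1 2 * A 2 2) ^ 2)
        - (A 0 0 * A 1 0 + A 0 1 * A 1 1 + A 0 2 * A 1 2) *
          ((A 0 0 * A 1 0 + A 0 1 * A 1 1 + A 0 2 * A 1 2) *
              (A 2 0 ^ 2 + A 2 1 ^ 2 + A 2 2 ^ 2)
            - (A 1 0 * A 2 0 + A 1 1 * A 2 1 + A 1 2 * A 2 2)
              * (A 0 0 * A 2 0 + A 0 1 * A 2 1 + A 0 2 * A 2 2))
        + (A 0 0 * A 2 0 + A 0 1 * A 2 1 + A 0 2 * A 2 2) *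
          ((A 0 0 * A 1 0 + A 0 1 * A 1 1 + A 0 2 * A 1 2) *
              (A 1 0 * A 2 0 + A 1 1 * A 2 1 + A 1 2 * A 2 2)
            - (A 1 0 ^ 2 + A 1 1 ^ 2 + A 1 2 ^ 2)
              * (A 0 0 * A 2 0 + A 0 1 * A 2 1 + A 0 2 * A 2 2)) := by
      rw [ht]; ring
    rw [g00, g11, g22, g01, g02, g12] at h
    have h' : t ^ 2 * (t - 1) = 0 := by linear_combination -h
    have := (mul_eq_zero.1 h').resolve_left (pow_ne_zero 2 hd)
    linarith
  have w0 : extSq A v 0 = v 0 * A 2 2 - v 1 * A 1 2 + v 2 * A 0 2 := by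
    simp [extSq_eq]; grind
  have w1 : extSq A v 1 = -(v 0 * A 2 1 - v 1 * A 1 1 + v 2 * A 0 1) := by
    simp [extSq_eq]; grind
  have w2 : extSq A v 2 = v 0 * A 2 0 - v 1 * A 1 0 + v 2 * A 0 0 := by
    simp [extSq_eq]; grind
  rw [w0, w1, w2]
  rw [ht1] at g00 g11 g22
  linear_combination v 0 ^ 2 * g22 + v 1 ^ 2 * g11 + v 2 ^ 2 * g00 - 2 * v 0 * v 1 * g12
    + 2 * v 0 * v 2 * g02 - 2 * v 1 * v 2 * g01

/-- The analogue of `extSq_su2` for the split form; here `N` exchanges two basis vectors. -/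
theorem extSq_sl2 {A : Matrix (Fin 3) (Fin 3) ℝ} (hA : IsAut .sl2 A) (v : Fin 3 → ℝ) :
    2 * extSq A v 0 * extSq A v 1 - extSq A v 2 ^ 2 = 2 * v 0 * v 1 - v 2 ^ 2 := by
  obtain ⟨hd, h1, h2, h3⟩ := hA
  simp [funext_iff, Fin.forall_fin_succ, brk, Row.b12, Row.b13, Row.b32] at h1 h2 h3
  obtain ⟨h10, h11, h12⟩ := h1
  obtain ⟨h20, h21, h22⟩ := h2
  obtain ⟨h30, h31, h32⟩ := h3
  rw [Matrix.det_fin_three] at hd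
  obtain ⟨t, ht⟩ : ∃ t, t = A 0 0 * A 1 1 * A 2 2 - A 0 0 * A 1 2 * A 2 1 - A 0 1 * A 1 0 * A 2 2
    + A 0 1 * A 1 2 * A 2 0 + A 0 2 * A 1 0 * A 2 1 - A 0 2 * A 1 1 * A 2 0 := ⟨_, rfl⟩
  rw [← ht] at hd
  have g00 : A 0 0 ^ 2 + 2 * A 0 1 * A 0 2 = t := by grind
  have g11 : A 1 0 ^ 2 + 2 * A 1 1 * A 1 2 = 0 := by grind
  have g22 : A 2 0 ^ 2 + 2 * A 2 1 * A 2 2 = 0 := by grind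
  have g01 : A 0 0 * A 1 0 + A 0 1 * A 1 2 + A 0 2 * A 1 1 = 0 := by grind
  have g02 : A 0 0 * A 2 0 + A 0 1 * A 2 2 + A 0 2 * A 2 1 = 0 := by grind
  have g12 : A 1 0 * A 2 0 + A 1 1 * A 2 2 + A 1 2 * A 2 1 = t := by grind
  have ht1 : t = 1 := by
    have h : -t ^ 2 = (A 0 0 ^ 2 + 2 * A 0 1 * A 0 2) *
        ((A 1 0 ^ 2 + 2 * A 1 1 * A 1 2) * (A 2 0 ^ 2 + 2 * A 2 1 * A 2 2)
          - (A 1 0 * A 2 0 + A 1 1 * A 2 2 + A 1 2 * A 2 1) ^ 2)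
        - (A 0 0 * A 1 0 + A 0 1 * A 1 2 + A 0 2 * A 1 1) *
          ((A 0 0 * A 1 0 + A 0 1 * A 1 2 + A 0 2 * A 1 1) *
              (A 2 0 ^ 2 + 2 * A 2 1 * A 2 2)
            - (A 1 0 * A 2 0 + A 1 1 * A 2 2 + A 1 2 * A 2 1)
              * (A 0 0 * A 2 0 + A 0 1 * A 2 2 + A 0 2 * A 2 1))
        + (A 0 0 * A 2 0 + A 0 1 * A 2 2 + A 0 2 * A 2 1) *
          ((A 0 0 * A 1 0 + A 0 1 * A 1 2 + A 0 2 * A 1 1) *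
              (A 1 0 * A 2 0 + A 1 1 * A 2 2 + A 1 2 * A 2 1)
            - (A 1 0 ^ 2 + 2 * A 1 1 * A 1 2)
              * (A 0 0 * A 2 0 + A 0 1 * A 2 2 + A 0 2 * A 2 1)) := by
      rw [ht]; ring
    rw [g00, g11, g22, g01, g02, g12] at h
    have h' : t ^ 2 * (t - 1) = 0 := by linear_combination h
    have := (mul_eq_zero.1 h').resolve_left (pow_ne_zero 2 hd)
    linarith
  have w0 : extSq A v 0 = v 0 * A 1 1 - v 1 * A 2 1 + v 2 * A 0 1 := by
    simp [extSq_eq]; grind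
  have w1 : extSq A v 1 = -(v 0 * A 1 2 - v 1 * A 2 2 + v 2 * A 0 2) := by
    simp [extSq_eq]; grind
  have w2 : extSq A v 2 = v 0 * A 1 0 - v 1 * A 2 0 + v 2 * A 0 0 := by
    simp [extSq_eq]; grind
  rw [w0, w1, w2]
  rw [ht1] at g00 g12
  linear_combination -v 0 ^ 2 * g11 - v 1 ^ 2 * g22 - v 2 ^ 2 * g00 + 2 * v 0 * v 1 * g12
    - 2 * v 0 * v 2 * g01 + 2 * v 1 * v 2 * g02

theorem extSq_h {A : Matrix (Fin 3) (Fin 3) ℝ} (hA : IsAut .h A) :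
    ∃ d, d ≠ 0 ∧ ∀ v, extSq A v 0 = d * v 0 := by
  obtain ⟨hd, h1, h2, h3⟩ := hA
  simp [funext_iff, Fin.forall_fin_succ, brk, Row.b12, Row.b13, Row.b32] at h1 h2 h3
  obtain ⟨h10, h11, h12⟩ := h1
  rw [Matrix.det_fin_three] at hd
  refine ⟨A 2 2, fun h => hd (by simp [← h10, ← h11, h]), fun v => ?_⟩
  simp [extSq_eq, ← h10, ← h11, ← h12]
  ring

/-- For a linear map `A` preserving `⟨e₂, e₃⟩`, the action of `Λ²A` on `Λ²g / ⟨e₂₃⟩` is that of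
`A` on `⟨e₂, e₃⟩`, scaled by the factor through which `A` acts on `g / ⟨e₂, e₃⟩`. -/
theorem extSq_of_ideal {A : Matrix (Fin 3) (Fin 3) ℝ} (hd : A.det ≠ 0) (h1 : A 1 0 = 0)
    (h2 : A 2 0 = 0) : A 0 0 ≠ 0 ∧ A 1 1 * A 2 2 - A 1 2 * A 2 1 ≠ 0 ∧ ∀ v,
      extSq A v 0 = A 0 0 * (v 0 * A 1 1 + v 1 * A 2 1) ∧
      extSq A v 1 = A 0 0 * (v 0 * A 1 2 + v 1 * A 2 2) := by
  have h3 : A 0 0 * (A 1 1 * A 2 2 - A 1 2 * A 2 1) ≠ 0 := by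
    rw [Matrix.det_fin_three] at hd
    simp [h1, h2] at hd
    convert hd using 1
    ring
  refine ⟨left_ne_zero_of_mul h3, right_ne_zero_of_mul h3, fun v => ?_⟩
  simp [extSq_eq, h1, h2]
  constructor <;> ring

theorem isAut_r3'zero_ideal {A : Matrix (Fin 3) (Fin 3) ℝ} (hA : IsAut .r3'zero A) :
    A 1 0 = 0 ∧ A 2 0 = 0 := by
  obtain ⟨hd, h1, h2, h3⟩ := hA
  simp [funext_iff, Fin.forall_fin_succ, brk, Row.b12, Row.b13, Row.b32] at h1 h2 h3
  grind

theorem isAut_r3negOne_ideal {A : Matrix (Fin 3) (Fin 3) ℝ} (hA : IsAut .r3negOne A) :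
    A 1 0 = 0 ∧ A 2 0 = 0 ∧ ((A 1 2 = 0 ∧ A 2 1 = 0) ∨ (A 1 1 = 0 ∧ A 2 2 = 0)) := by
  obtain ⟨hd, h1, h2, h3⟩ := hA
  simp [funext_iff, Fin.forall_fin_succ, brk, Row.b12, Row.b13, Row.b32] at h1 h2 h3
  grind

theorem isAut_r3one_ideal {A : Matrix (Fin 3) (Fin 3) ℝ} (hA : IsAut .r3one A) :
    A 1 0 = 0 ∧ A 2 0 = 0 := by
  obtain ⟨hd, h1, h2, h3⟩ := hA
  simp [funext_iff, Fin.forall_fin_succ, brk, Row.b12, Row.b13, Row.b32] at h1 h2 h3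
  grind

theorem isAut_r3_entries {A : Matrix (Fin 3) (Fin 3) ℝ} (hA : IsAut .r3 A) :
    A 0 1 = 0 ∧ A 0 2 = 0 ∧ A 1 2 = 0 ∧ A 2 2 = 1 ∧ A 0 0 = A 1 1 := by
  obtain ⟨hd, h1, h2, h3⟩ := hA
  rw [Matrix.det_fin_three] at hd
  simp [funext_iff, Fin.forall_fin_succ, brk, Row.b12, Row.b13, Row.b32] at h1 h2 h3
  grind

theorem isAut_r3lam_entries {lam : ℝ} {hlam} {A : Matrix (Fin 3) (Fin 3) ℝ}
    (hA : IsAut (.r3lam lam hlam) A) :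
    A 0 1 = 0 ∧ A 0 2 = 0 ∧ A 1 0 = 0 ∧ A 1 2 = 0 ∧ A 2 2 = 1 := by
  obtain ⟨hd, h1, h2, h3⟩ := hA
  have hl : 1 - lam ≠ 0 := by linarith [hlam.2]
  rw [Matrix.det_fin_three] at hd
  simp [funext_iff, Fin.forall_fin_succ, brk, Row.b12, Row.b13, Row.b32] at h1 h2 h3
  grind

theorem isAut_r3'lam_entries {lam : ℝ} {hlam} {A : Matrix (Fin 3) (Fin 3) ℝ}
    (hA : IsAut (.r3'lam lam hlam) A) :
    A 0 2 = 0 ∧ A 1 2 = 0 ∧ A 2 2 = 1 ∧ A 0 0 = A 1 1 ∧ A 0 1 = -A 1 0 := by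
  obtain ⟨hd, h1, h2, h3⟩ := hA
  rw [Matrix.det_fin_three] at hd
  simp [funext_iff, Fin.forall_fin_succ, brk, Row.b12, Row.b13, Row.b32] at h1 h2 h3
  grind

theorem mem_orbit_of_reducedEquiv {ρ : Row} {c : OrbitClass} (hc : c ∈ ρ.classes)
    {v : Fin 3 → ℝ} (hv : ReducedEquiv (biv ρ v) (biv ρ c.rep)) : v ∈ c.orbit := by
  rw [reducedEquiv_biv_iff] at hv
  obtain ⟨A, hA, hw⟩ := hv
  have hzero : ∀ {v : Fin 3 → ℝ}, extSq A v - 0 = 0 → v = 0 := fun h =>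
    eq_zero_of_extSq_eq_zero hA.det_ne_zero (by simpa using h)
  cases ρ with
  | sl2 =>
    have hQ := extSq_sl2 hA v
    rcases hc with ((rfl | rfl) | ⟨k, hk, rfl⟩) | ⟨k, hk, rfl⟩
    · exact hzero hw
    · rw [sub_eq_zero.1 hw] at hQ
      refine ⟨by simpa using hQ.symm, ?_⟩
      rintro rfl
      have := congrFun hw 0
      simp [extSq] at this
    · rw [sub_eq_zero.1 hw] at hQ
      simpa using hQ.symm
    · rw [sub_eq_zero.1 hw] at hQ
      simp at hQ
      change _ = _
      linarith
  | su2 =>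
    have hQ := extSq_su2 hA v
    rcases hc with rfl | ⟨a, ha, rfl⟩
    · exact hzero hw
    · rw [sub_eq_zero.1 hw] at hQ
      simpa using hQ.symm
  | h =>
    obtain ⟨d, hd, h⟩ := extSq_h hA
    rcases hc with rfl | rfl
    · simpa [Row.invariants, h, hd] using hw
    · simp only [Row.invariants, Set.mem_ofPred_eq, Pi.sub_apply, h] at hw
      simp at hw ⊢
      grind
  | r3'zero =>
    obtain ⟨h1, h2⟩ := isAut_r3'zero_ideal hA
    obtain ⟨h00, hm, h⟩ := extSq_of_ideal hA.det_ne_zero h1 h2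
    rcases hc with rfl | rfl
    · simp [Row.invariants, h, h00] at hw ⊢
      grind
    · simp only [Row.invariants, Set.mem_ofPred_eq, Pi.sub_apply, h] at hw
      simp at hw ⊢
      by_contra! hn
      have e0 : v 0 = 0 := by nlinarith [sq_nonneg (v 0), sq_nonneg (v 1)]
      have e1 : v 1 = 0 := by nlinarith [sq_nonneg (v 0), sq_nonneg (v 1)]
      simp [e0, e1] at hw
  | r3negOne =>
    obtain ⟨h1, h2, h3⟩ := isAut_r3negOne_ideal hA
    obtain ⟨h00, hm, h⟩ := extSq_of_ideal hA.det_ne_zero h1 h2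
    rcases hc with rfl | rfl | rfl
    · simp [Row.invariants, h, h00] at hw ⊢
      grind
    · simp only [Row.invariants, Set.mem_ofPred_eq, Pi.sub_apply, h] at hw
      simp at hw ⊢
      grind
    · simp only [Row.invariants, Set.mem_ofPred_eq, Pi.sub_apply, h] at hw
      simp at hw ⊢
      grind
  | r3one =>
    obtain ⟨h1, h2⟩ := isAut_r3one_ideal hA
    obtain ⟨h00, hm, h⟩ := extSq_of_ideal hA.det_ne_zero h1 h2
    rcases hc with rfl | rfl | rfl
    · exact hzero hw
    · have hw := sub_eq_zero.1 hw
      have hw1 := congrFun hw 1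
      simp [h] at hw1
      intro hn
      have e0 : v 0 = 0 := by nlinarith [sq_nonneg (v 0), sq_nonneg (v 1)]
      have e1 : v 1 = 0 := by nlinarith [sq_nonneg (v 0), sq_nonneg (v 1)]
      simp [e0, e1] at hw1
    · have hw := sub_eq_zero.1 hw
      have hw0 := congrFun hw 0
      have hw1 := congrFun hw 1
      have hw2 := congrFun hw 2
      simp [h, h00] at hw0 hw1
      have e0 : v 0 = 0 := by grind
      have e1 : v 1 = 0 := by grind
      refine ⟨e0, e1, ?_⟩
      rintro e2
      simp [extSq, e0, e1, e2] at hw2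
  | r3 =>
    obtain ⟨h01, h02, h12, h22, h00⟩ := isAut_r3_entries hA
    have hd := hA.det_ne_zero
    rw [Matrix.det_fin_three] at hd
    simp [h01, h02, h12, h22, h00] at hd
    have hp : 0 < A 1 1 ^ 2 := by positivity
    rcases hc with rfl | rfl | rfl | rfl
    · exact hzero hw
    all_goals
      have hw := (sub_eq_zero.1 hw).symm
      rw [extSq_eq, vec_eq_iff] at hw
      simp [h01, h02, h12, h22, h00] at hw ⊢
      obtain ⟨hw0, hw1, hw2⟩ := hw
    · have e2 : v 2 = 0 := by grind
      have e1 : v 1 = 0 := by grind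
      refine ⟨?_, e1, e2⟩
      simp [e1, e2] at hw0
      by_contra! hn
      nlinarith
    · have e2 : v 2 = 0 := by grind
      have e1 : v 1 = 0 := by grind
      refine ⟨?_, e1, e2⟩
      simp [e1, e2] at hw0
      by_contra! hn
      nlinarith
    · grind
  | r3lam lam hlam =>
    obtain ⟨h01, h02, h10, h12, h22⟩ := isAut_r3lam_entries hA
    have hd := hA.det_ne_zero
    rw [Matrix.det_fin_three] at hd
    simp [h01, h02, h10, h12, h22] at hd
    rcases hc with rfl | rfl | rfl | rfl
    · exact hzero hw
    all_goals
      have hw := (sub_eq_zero.1 hw).symm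
      rw [extSq_eq, vec_eq_iff] at hw
      simp [h01, h02, h10, h12, h22] at hw ⊢
      grind
  | r3'lam lam hlam =>
    obtain ⟨h02, h12, h22, h00, h01⟩ := isAut_r3'lam_entries hA
    have hd := hA.det_ne_zero
    rw [Matrix.det_fin_three] at hd
    simp [h01, h02, h12, h22, h00] at hd
    have hp : 0 < A 1 1 ^ 2 + A 1 0 ^ 2 := by
      refine lt_of_le_of_ne (by positivity) fun h => hd ?_
      linear_combination -h
    rcases hc with rfl | rfl | rfl
    · exact hzero hw
    all_goals
      have hw := (sub_eq_zero.1 hw).symm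
      rw [extSq_eq, vec_eq_iff] at hw
      simp [h01, h02, h12, h22, h00] at hw ⊢
      obtain ⟨hw0, hw1, hw2⟩ := hw
      have e2 : v 2 = 0 := by grind
      have e1 : v 1 = 0 := by grind
      refine ⟨?_, e1, e2⟩
      simp [e1, e2] at hw0
      by_contra! hn
      nlinarith

/-! ### The orbits partition the set of `r`-matrices -/

theorem orbit_subset_rMatrices {ρ : Row} {c : OrbitClass} (hc : c ∈ ρ.classes) :
    c.orbit ⊆ ρ.rMatrices := by
  intro v hv
  cases ρ with
  | r3 => rcases hc with rfl | rfl | rfl | rfl <;> simp_all [Row.rMatrices]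
  | r3lam lam hlam => rcases hc with rfl | rfl | rfl | rfl <;> simp_all [Row.rMatrices]
  | r3'lam lam hlam => rcases hc with rfl | rfl | rfl <;> simp_all [Row.rMatrices]
  | _ => trivial

theorem rep_mem_orbit {ρ : Row} {c : OrbitClass} (hc : c ∈ ρ.classes) : c.rep ∈ c.orbit := by
  refine mem_orbit_of_reducedEquiv hc (reducedEquiv_of_extSq 1 (isAut_one ρ) ?_)
  rw [extSq_eq, eq_comm, vec_eq_iff]
  simp

theorem exists_mem_orbit {ρ : Row} {v : Fin 3 → ℝ} (hv : v ∈ ρ.rMatrices) :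
    ∃ c ∈ ρ.classes, v ∈ c.orbit := by
  cases ρ with
  | sl2 =>
    rcases lt_trichotomy (2 * v 0 * v 1 - v 2 ^ 2) 0 with h | h | h
    · refine ⟨_, .inl (.inr ⟨_, Real.sqrt_pos.2 (neg_pos.2 h), rfl⟩), ?_⟩
      simp only [Set.mem_ofPred_eq]
      rw [Real.sq_sqrt (neg_pos.2 h).le, neg_neg]
    · by_cases hv0 : v = 0
      · exact ⟨_, .inl (.inl (.inl rfl)), hv0⟩
      · exact ⟨_, .inl (.inl (.inr rfl)), h, hv0⟩
    · refine ⟨_, .inr ⟨_, Real.sqrt_pos.2 (half_pos h), rfl⟩, ?_⟩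
      simp only [Set.mem_ofPred_eq]
      rw [Real.sq_sqrt (half_pos h).le]
      ring
  | su2 =>
    by_cases hv0 : v = 0
    · exact ⟨_, .inl rfl, hv0⟩
    · have h : 0 < v 0 ^ 2 + v 1 ^ 2 + v 2 ^ 2 := by
        refine lt_of_le_of_ne (by positivity) fun h => hv0 ((vec_eq_zero_iff v).2 ?_)
        refine ⟨?_, ?_, ?_⟩ <;> nlinarith [sq_nonneg (v 0), sq_nonneg (v 1), sq_nonneg (v 2)]
      exact ⟨_, .inr ⟨_, Real.sqrt_pos.2 h, rfl⟩, (Real.sq_sqrt h.le).symm⟩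
  | h => simp [Row.classes, em]
  | r3'zero =>
    simp [Row.classes]
    by_contra! hn
    have e0 : v 0 = 0 := by nlinarith [sq_nonneg (v 0), sq_nonneg (v 1)]
    have e1 : v 1 = 0 := by nlinarith [sq_nonneg (v 0), sq_nonneg (v 1)]
    exact hn.1 e0 e1
  | r3negOne =>
    simp [Row.classes]
    by_contra! hn
    have e0 : v 0 ^ 2 + v 1 ^ 2 = 0 := by grind
    have e0 : v 0 = 0 := by nlinarith [sq_nonneg (v 0), sq_nonneg (v 1)]
    have e1 : v 1 = 0 := by nlinarith [sq_nonneg (v 0), sq_nonneg (v 1)]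
    exact hn.1 e0 e1
  | r3one =>
    simp [Row.classes, vec_eq_zero_iff]
    by_contra! hn
    have e0 : v 0 ^ 2 + v 1 ^ 2 = 0 := by grind
    have e0 : v 0 = 0 := by nlinarith [sq_nonneg (v 0), sq_nonneg (v 1)]
    have e1 : v 1 = 0 := by nlinarith [sq_nonneg (v 0), sq_nonneg (v 1)]
    grind
  | r3 =>
    simp [Row.classes, vec_eq_zero_iff, Row.rMatrices] at hv ⊢
    grind
  | r3lam lam hlam =>
    simp [Row.classes, vec_eq_zero_iff, Row.rMatrices] at hv ⊢
    grind
  | r3'lam lam hlam =>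
    simp [Row.classes, vec_eq_zero_iff, Row.rMatrices] at hv ⊢
    grind

theorem eq_of_mem_orbit {ρ : Row} {c d : OrbitClass} (hc : c ∈ ρ.classes) (hd : d ∈ ρ.classes)
    {v : Fin 3 → ℝ} (hvc : v ∈ c.orbit) (hvd : v ∈ d.orbit) : c = d := by
  have hsq : ∀ k l : ℝ, 0 < k → 0 < l → k ^ 2 = l ^ 2 → k = l := fun k l hk hl h =>
    (pow_left_inj₀ hk.le hl.le two_ne_zero).1 h
  have hpos : ∀ k : ℝ, 0 < k → 0 < k ^ 2 := fun k hk => pow_pos hk 2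
  cases ρ with
  | sl2 =>
    rcases hc with ((rfl | rfl) | ⟨k, hk, rfl⟩) | ⟨k, hk, rfl⟩ <;>
      rcases hd with ((rfl | rfl) | ⟨l, hl, rfl⟩) | ⟨l, hl, rfl⟩ <;>
      simp only [Set.mem_singleton_iff, Set.mem_ofPred_eq, vec_eq_zero_iff, ne_eq] at hvc hvd <;>
      first
        | rfl
        | (exfalso; grind)
        | (obtain rfl := hsq k l hk hl (by linarith); rfl)
  | su2 =>
    rcases hc with rfl | ⟨k, hk, rfl⟩ <;> rcases hd with rfl | ⟨l, hl, rfl⟩ <;>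
      simp only [Set.mem_singleton_iff, Set.mem_ofPred_eq, vec_eq_zero_iff] at hvc hvd <;>
      first
        | rfl
        | (exfalso; grind)
        | (obtain rfl := hsq k l hk hl (by linarith); rfl)
  | h =>
    rcases hc with rfl | rfl <;> rcases hd with rfl | rfl <;> simp at hvc hvd ⊢ <;> grind
  | r3'zero =>
    rcases hc with rfl | rfl <;> rcases hd with rfl | rfl
    · rfl
    · simp [hvc.1, hvc.2] at hvd
    · simp [hvd.1, hvd.2] at hvc
    · rfl
  | r3negOne =>
    rcases hc with rfl | rfl | rfl <;> rcases hd with rfl | rfl | rfl <;>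
      simp at hvc hvd ⊢ <;> grind
  | r3one =>
    rcases hc with rfl | rfl | rfl <;> rcases hd with rfl | rfl | rfl <;>
      simp [vec_eq_zero_iff] at hvc hvd ⊢ <;> grind
  | r3 =>
    rcases hc with rfl | rfl | rfl | rfl <;> rcases hd with rfl | rfl | rfl | rfl <;>
      simp [vec_eq_zero_iff] at hvc hvd ⊢ <;> grind
  | r3lam lam hlam =>
    rcases hc with rfl | rfl | rfl | rfl <;> rcases hd with rfl | rfl | rfl | rfl <;>
      simp [vec_eq_zero_iff] at hvc hvd ⊢ <;> grind
  | r3'lam lam hlam =>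
    rcases hc with rfl | rfl | rfl <;> rcases hd with rfl | rfl | rfl <;>
      simp [vec_eq_zero_iff] at hvc hvd ⊢ <;> grind

end Alg

end CoboundaryBialgebra

end

open CoboundaryBialgebra in
theorem mainTheorem2 :
    -- every real three-dimensional Lie algebra is abelian or isomorphic to one of the list
    (∀ (L : Type*) [LieRing L] [LieAlgebra ℝ L], Module.finrank ℝ L = 3 →
      IsLieAbelian L ∨ ∃ ρ : Row, Nonempty (L ≃ₗ⁅ℝ⁆ Alg ρ)) ∧
    ∀ ρ : Row,
      -- the `r`-matrices
      (∀ r : TensorProduct ℝ (Alg ρ) (Alg ρ),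
        IsRMatrix r ↔ ∃ v ∈ ρ.rMatrices, r = Alg.biv ρ v) ∧
      -- the invariant bivectors
      (∀ r : TensorProduct ℝ (Alg ρ) (Alg ρ),
        r ∈ invariantBivectors (Alg ρ) ↔ ∃ v ∈ ρ.invariants, r = Alg.biv ρ v) ∧
      -- the representatives are `r`-matrices inducing coboundary Lie bialgebras,
      -- and their orbits are the indicated sets
      (∀ c ∈ ρ.classes, IsRMatrix (Alg.biv ρ c.rep) ∧
        IsCoboundaryCocommutator (coboundary (Alg.biv ρ c.rep)) ∧
        c.orbit = {v | IsRMatrix (Alg.biv ρ v) ∧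
          ReducedEquiv (Alg.biv ρ v) (Alg.biv ρ c.rep)}) ∧
      -- classification of (reduced) `r`-matrices
      (∀ r : TensorProduct ℝ (Alg ρ) (Alg ρ), IsRMatrix r →
        ∃! c : OrbitClass, c ∈ ρ.classes ∧ ReducedEquiv r (Alg.biv ρ c.rep)) ∧
      -- classification of coboundary Lie bialgebra structures
      (∀ δ : Alg ρ →ₗ[ℝ] TensorProduct ℝ (Alg ρ) (Alg ρ), IsCoboundaryCocommutator δ →
        ∃! c : OrbitClass, c ∈ ρ.classes ∧
          CocommutatorEquiv δ (coboundary (Alg.biv ρ c.rep))) := by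
  refine ⟨fun L _ _ hL => ThreeDim.classification hL, fun ρ => ?_⟩
  have hunique : ∀ v ∈ ρ.rMatrices, ∃! c : OrbitClass, c ∈ ρ.classes ∧
      ReducedEquiv (Alg.biv ρ v) (Alg.biv ρ c.rep) := by
    intro v hv
    obtain ⟨c, hc, hvc⟩ := Alg.exists_mem_orbit hv
    exact ⟨c, ⟨hc, Alg.reducedEquiv_rep hc hvc⟩, fun d hd =>
      Alg.eq_of_mem_orbit hd.1 hc (Alg.mem_orbit_of_reducedEquiv hd.1 hd.2) hvc⟩
  refine ⟨Alg.isRMatrix_iff ρ, Alg.mem_invariants_iff ρ, fun c hc => ?_, fun r hr => ?_,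
    fun δ hδ => ?_⟩
  · have hrep := Alg.orbit_subset_rMatrices hc (Alg.rep_mem_orbit hc)
    refine ⟨(Alg.isRMatrix_biv_iff ρ _).2 hrep,
      ⟨(Alg.isCocommutator_coboundary_biv_iff ρ _).2 hrep, _, rfl⟩, ?_⟩
    ext v
    exact ⟨fun hv => ⟨(Alg.isRMatrix_biv_iff ρ v).2 (Alg.orbit_subset_rMatrices hc hv),
      Alg.reducedEquiv_rep hc hv⟩, fun hv => Alg.mem_orbit_of_reducedEquiv hc hv.2⟩
  · obtain ⟨v, hv, rfl⟩ := (Alg.isRMatrix_iff ρ r).1 hr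
    exact hunique v hv
  · obtain ⟨v, hv, rfl⟩ := Alg.exists_rMatrix_of_isCoboundaryCocommutator ρ hδ
    simpa only [cocommutatorEquiv_coboundary_iff (Alg.biv_mem_bivectors ρ _)
      (Alg.biv_mem_bivectors ρ _)] using hunique v hv
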